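/- Let $q$ be a power of a prime and $K=\mathbb F_q(t)$. For $A_0(t)=\sum_i a_it^i\in\mathbb F_q[t]$ write $A_0(\mathbf F)=\sum_i a_it^{q^i}$ for the associated $\mathbb F_q$-additive polynomial. Let $A_0\in\mathbb F_q[t]$ be non-zero, put $A=A_0(\mathbf F)$, let $k_1,\dots,k_m$ be distinct odd positive integers such that $t^{k_i}-1$ divides $A_0$ for every $i$, and put $B_i=A_0/(t^{k_i}-1)\in\mathbb F_q[t]$. A point of one of the curves $E_A$ below is $\infty$-integral if its affine coordinates $x,y$ in the displayed equation lie in $\mathbb F_q[t]$; it is separable if it is non-constant and lies in the Frobenius orbit of no other point of $E_A(K)$. Here non-constant means that it corresponds to a non-constant point under the isomorphism over $\overline K$ between $E_A$ and the curve obtained by replacing $A$ by $1$, i.e. $x\notin\mathbb F_q$ in (1) and $y\notin\mathbb F_q$ in (2). The Frobenius orbit of an affine point $(x,y)$ is $\{(x^{q^i},A^{(q^i-1)/2}y^{q^i}):i\ge 0\}$ in (1) and $\{(A^{(q^{2i}-1)/3}x^{q^{2i}},y^{q^{2i}}):i\ge 0\}$ in (2), and that of the point at infinity is the point itself. For $n\ge1$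 let $\tau_{\rm odd}(n)$ be the number of odd divisors of $n$, and for $k\mid n$ let $T^n_k(t)=\sum_{0\le i<n/k}t^{q^{ki}}$. (1) Let $q\equiv 3\pmod 4$. Then $$Q_i=\bigl(B_i(\mathbf F)^{(q^{k_i}-1)/2},\,B_i(\mathbf F)^{(q^{k_i}-3)/4}\bigr),\qquad 1\le i\le m,$$ are $\infty$-integral points of the elliptic curve $E_A: A y^2=x^3-x$ over $K$, they are separable if $A_0(0)\neq0$, and they are $\mathbb Z$-linearly independent in the Mordell–Weil group $E_A(K)$. In particular, for every $n\ge1$, the points $\bigl((T^n_k)^{(q^k-1)/2},(T^n_k)^{(q^k-3)/4}\bigr)$, with $k$ running through the odd divisors of $n$, are separable $\infty$-integral points of $(t^{q^n}-t)y^2=x^3-x$ and are $\mathbb Z$-linearly independent; hence the rank of this curve over $K$ is at least $\tau_{\rm odd}(n)$. (2) Let $q\equiv 2\pmod 3$. Then $$S_i=\bigl(B_i(\mathbf F)^{(q^{k_i}-2)/3},\,B_i(\mathbf F)^{q^{k_i}-1}\bigr),\qquad 1\le i\le m,$$ are $\infty$-integral points of the elliptic curve $E_A: y^2-y=A x^3$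 over $K$, they are separable if $A_0(0)\neq0$, and they are $\mathbb Z$-linearly independent in the Mordell–Weil group $E_A(K)$. In particular, for every $n\ge1$, the points $\bigl((T^n_k)^{(q^k-2)/3},(T^n_k)^{q^k-1}\bigr)$, with $k$ running through the odd divisors of $n$, are separable $\infty$-integral points of $y^2-y=(t^{q^n}-t)x^3$ and are $\mathbb Z$-linearly independent; hence the rank of this curve over $K$ is at least $\tau_{\rm odd}(n)$. -/

import Mathlib

open Polynomial

noncomputable section

namespace TwistPoints

/-- The `𝔽_q`-additive polynomial `A(t) = A₀(𝐅) = ∑ aᵢ t^(q^i)` attached to `A₀ = ∑ aᵢ t^i`,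
where `q` is the number of elements of the coefficient field. -/
def additivePoly {F : Type*} [Field F] [Fintype F] (A₀ : F[X]) : F[X] :=
  A₀.sum fun i a => C a * X ^ (Fintype.card F ^ i)

/-- The trace polynomial `T^n_k(t) = ∑_{0 ≤ i < n/k} t^(q^(k i))`, for `k ∣ n`. -/
def tracePoly (F : Type*) [Field F] [Fintype F] (n k : ℕ) : F[X] :=
  ∑ i ∈ Finset.range (n / k), X ^ (Fintype.card F ^ (k * i))

/-- The odd divisors of `n`; for `n ≥ 1` their number is `τ_odd(n)`. -/
def oddDivisors (n : ℕ) : Finset ℕ := n.divisors.filter Odd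

/-! ### The quadratic twist `A y² = x³ - x` -/

/-- Weierstrass model `Y² = X³ - A² X` of the quadratic twist `A y² = x³ - x`,
under the change of variables `X = A x`, `Y = A² y`. -/
def quadTwist {K : Type*} [Field K] (A : K) : WeierstrassCurve K :=
  { a₁ := 0, a₂ := 0, a₃ := 0, a₄ := -A ^ 2, a₆ := 0 }

/-- `P` is the point of `A y² = x³ - x` with affine coordinates `(x, y)`
(coordinates of the twisted equation, not of the Weierstrass model). -/
def QuadCoords {K : Type*} [Field K] (A : K) (P : (quadTwist A).toAffine.Point)
    (x y : K) : Prop :=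
  ∃ h : (quadTwist A).toAffine.Nonsingular (A * x) (A ^ 2 * y),
    P = WeierstrassCurve.Affine.Point.some (A * x) (A ^ 2 * y) h

/-- The twist is an elliptic curve, away from characteristic two. -/
theorem quadTwist_isElliptic {K : Type*} [Field K] {A : K} (hA : A ≠ 0) (h2 : (2 : K) ≠ 0) :
    (quadTwist A).IsElliptic := by
  refine ⟨?_⟩
  have h : (quadTwist A).Δ = 2 ^ 6 * A ^ 6 := by
    simp only [quadTwist, WeierstrassCurve.Δ, WeierstrassCurve.b₂, WeierstrassCurve.b₄,
      WeierstrassCurve.b₆, WeierstrassCurve.b₈]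
    ring
  rw [h]
  exact (mul_ne_zero (pow_ne_zero _ h2) (pow_ne_zero _ hA)).isUnit

/-- The pairs that are coordinates of a point are exactly the solutions of `A y² = x³ - x`. -/
theorem exists_quadCoords_iff {K : Type*} [Field K] {A : K} (hA : A ≠ 0) (h2 : (2 : K) ≠ 0)
    (x y : K) : (∃ P, QuadCoords A P x y) ↔ A * y ^ 2 = x ^ 3 - x := by
  haveI := quadTwist_isElliptic hA h2
  have key : (quadTwist A).toAffine.Nonsingular (A * x) (A ^ 2 * y) ↔
      A * y ^ 2 = x ^ 3 - x := by
    rw [← WeierstrassCurve.Affine.equation_iff_nonsingular,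
      WeierstrassCurve.Affine.equation_iff]
    simp only [quadTwist]
    constructor
    · intro h
      apply mul_left_cancel₀ (pow_ne_zero 3 hA)
      linear_combination h
    · intro h
      linear_combination A ^ 3 * h
  exact ⟨fun ⟨_, h, _⟩ => key.1 h, fun h => ⟨_, key.2 h, rfl⟩⟩

/-- Every point other than `O` has affine coordinates. -/
theorem exists_quadCoords {K : Type*} [Field K] {A : K} (hA : A ≠ 0)
    (P : (quadTwist A).toAffine.Point) (hP : P ≠ 0) : ∃ x y, QuadCoords A P x y := by
  rcases P with _ | ⟨X, Y, h⟩
  · exact absurd rfl hP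
  · have hX : A * (X / A) = X := by field_simp
    have hY : A ^ 2 * (Y / A ^ 2) = Y := by field_simp
    refine ⟨X / A, Y / A ^ 2, ?_, ?_⟩
    · rw [hX, hY]; exact h
    · simp only [hX, hY]

/-- The Frobenius orbit of `P`: the `i`-th iterate of the `q`-Frobenius endomorphism of the twist
is `(x, y) ↦ (x^(q^i), A^((q^i - 1)/2) y^(q^i))`, and it fixes `O`. -/
def quadFrobeniusOrbit {K : Type*} [Field K] (q : ℕ) (A : K)
    (P : (quadTwist A).toAffine.Point) : Set (quadTwist A).toAffine.Point :=
  {R | (P = 0 ∧ R = 0) ∨ ∃ (i : ℕ) (x y : K), QuadCoords A P x y ∧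
    QuadCoords A R (x ^ q ^ i) (A ^ ((q ^ i - 1) / 2) * y ^ q ^ i)}

/-- A separable point: it is non-constant (an affine point whose image `(x, y √A)` on the constant
curve `y² = x³ - x` is not constant, that is, `x` is not constant) and it lies in the Frobenius
orbit of no other rational point. -/
def QuadSeparable {F : Type*} [Field F] [Fintype F] (A : RatFunc F)
    (P : (quadTwist A).toAffine.Point) : Prop :=
  (∃ x y, QuadCoords A P x y ∧ x ∉ Set.range (RatFunc.C : F →+* RatFunc F)) ∧
    ∀ R, P ∈ quadFrobeniusOrbit (Fintype.card F) A R → R = P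

/-! ### The cubic twist `y² - y = A x³` -/

/-- Weierstrass model `Y² - A Y = X³` of the cubic twist `y² - y = A x³`,
under the change of variables `X = A x`, `Y = A y`. -/
def cubicTwist {K : Type*} [Field K] (A : K) : WeierstrassCurve K :=
  { a₁ := 0, a₂ := 0, a₃ := -A, a₄ := 0, a₆ := 0 }

/-- `P` is the point of `y² - y = A x³` with affine coordinates `(x, y)`
(coordinates of the twisted equation, not of the Weierstrass model). -/
def CubicCoords {K : Type*} [Field K] (A : K) (P : (cubicTwist A).toAffine.Point)
    (x y : K) : Prop :=
  ∃ h : (cubicTwist A).toAffine.Nonsingular (A * x) (A * y),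
    P = WeierstrassCurve.Affine.Point.some (A * x) (A * y) h

/-- The twist is an elliptic curve, away from characteristic three. -/
theorem cubicTwist_isElliptic {K : Type*} [Field K] {A : K} (hA : A ≠ 0) (h3 : (3 : K) ≠ 0) :
    (cubicTwist A).IsElliptic := by
  refine ⟨?_⟩
  have h : (cubicTwist A).Δ = -(3 ^ 3 * A ^ 4) := by
    simp only [cubicTwist, WeierstrassCurve.Δ, WeierstrassCurve.b₂, WeierstrassCurve.b₄,
      WeierstrassCurve.b₆, WeierstrassCurve.b₈]
    ring
  rw [h]
  exact (neg_ne_zero.2 (mul_ne_zero (pow_ne_zero _ h3) (pow_ne_zero _ hA))).isUnit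

/-- The pairs that are coordinates of a point are exactly the solutions of `y² - y = A x³`. -/
theorem exists_cubicCoords_iff {K : Type*} [Field K] {A : K} (hA : A ≠ 0) (h3 : (3 : K) ≠ 0)
    (x y : K) : (∃ P, CubicCoords A P x y) ↔ y ^ 2 - y = A * x ^ 3 := by
  haveI := cubicTwist_isElliptic hA h3
  have key : (cubicTwist A).toAffine.Nonsingular (A * x) (A * y) ↔
      y ^ 2 - y = A * x ^ 3 := by
    rw [← WeierstrassCurve.Affine.equation_iff_nonsingular,
      WeierstrassCurve.Affine.equation_iff]
    simp only [cubicTwist]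
    constructor
    · intro h
      apply mul_left_cancel₀ (pow_ne_zero 2 hA)
      linear_combination h
    · intro h
      linear_combination A ^ 2 * h
  exact ⟨fun ⟨_, h, _⟩ => key.1 h, fun h => ⟨_, key.2 h, rfl⟩⟩

/-- Every point other than `O` has affine coordinates. -/
theorem exists_cubicCoords {K : Type*} [Field K] {A : K} (hA : A ≠ 0)
    (P : (cubicTwist A).toAffine.Point) (hP : P ≠ 0) : ∃ x y, CubicCoords A P x y := by
  rcases P with _ | ⟨X, Y, h⟩
  · exact absurd rfl hP
  · have hX : A * (X / A) = X := by field_simp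
    have hY : A * (Y / A) = Y := by field_simp
    refine ⟨X / A, Y / A, ?_, ?_⟩
    · rw [hX, hY]; exact h
    · simp only [hX, hY]

/-- The Frobenius orbit of `P` for `q ≡ 2 mod 3`: it consists of the images of `P` under
`(x, y) ↦ (A^((q^(2i) - 1)/3) x^(q^(2i)), y^(q^(2i)))`, the even iterates of the `q`-Frobenius
(those which are defined over the ground field); `O` is fixed. -/
def cubicFrobeniusOrbit {K : Type*} [Field K] (q : ℕ) (A : K)
    (P : (cubicTwist A).toAffine.Point) : Set (cubicTwist A).toAffine.Point :=
  {R | (P = 0 ∧ R = 0) ∨ ∃ (i : ℕ) (x y : K), CubicCoords A P x y ∧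
    CubicCoords A R (A ^ ((q ^ (2 * i) - 1) / 3) * x ^ q ^ (2 * i)) (y ^ q ^ (2 * i))}

/-- A separable point: it is non-constant (an affine point whose image `(x ∛A, y)` on the constant
curve `y² - y = x³` is not constant, that is, `y` is not constant) and it lies in the Frobenius
orbit of no other rational point. -/
def CubicSeparable {F : Type*} [Field F] [Fintype F] (A : RatFunc F)
    (P : (cubicTwist A).toAffine.Point) : Prop :=
  (∃ x y, CubicCoords A P x y ∧ y ∉ Set.range (RatFunc.C : F →+* RatFunc F)) ∧
    ∀ R, P ∈ cubicFrobeniusOrbit (Fintype.card F) A R → R = P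

end TwistPoints

end

open Polynomial

noncomputable section

namespace TwistPoints

/-! Over an extension containing a square root (cube root) of `A`, the twist becomes a constant
curve. Evaluating the pullback of its invariant differential on `d/dt`, and rescaling by a power of
`A`, gives maps `P ↦ D(x)/y` and `P ↦ D(y)/x²` from `E_A(K)` to `K`. They are homomorphisms; this is
proved from the chord and tangent formulas (`quadDiff_add`, `cubicDiff_add`).

Write `b = B_i(𝐅)` and `q^k = sN + r`, with `k = k_i` and `(s, r) = (4, 3)` or `(3, 2)`.
Multiplication of `A₀` by `t` corresponds to raising `A₀(𝐅)` to the power `q`, so `A = b^(q^k) - b`,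
which puts the point on the curve. The derivative of `b` is the constant `B_i(0)`, so the
differential of the point is a constant multiple of `b^N`. If `A₀(0) ≠ 0`, these constants are
non-zero and the powers `b^N` have pairwise distinct degrees, hence the differentials are
independent modulo the characteristic `p`. The same non-vanishing shows that the relevant coordinate
is neither constant nor a `q`-th power, which gives separability.

Independence modulo `p` lifts to independence over `ℤ` because the differential kills `p`-power
torsion: a relation has all coefficients divisible by `p`, the quotient relation holds up to
`p`-torsion, and the argument repeats (`linearIndependent_of_map_modP`). No finite generation of
`E_A(K)` is needed. For odd `p`, torsion is handled by a height that doubling multiplies by 4: on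
odd torsion it vanishes, so the coordinate is constant. For `p = 2`, which concerns only the cubic
twist, there is no `2`-power torsion.

If `A₀(0) = 0`, every `B_i` is divisible by `t` as well, and the points are Frobenius images of
those for `A₀/t`; induction on the degree reduces to the previous case. -/

/-- A map that is odd, vanishes on `Z`, and is additive at pairs whose sum is not in `Z`,
is additive. -/
theorem map_add_of_off_set {G M : Type*} [AddCommGroup G] [AddCommGroup M] (f : G → M)
    (Z : Set G) (hneg : ∀ P, f (-P) = -f P) (hZ : ∀ P ∈ Z, f P = 0)
    (hadd : ∀ P Q, P + Q ∉ Z → f (P + Q) = f P + f Q) (P Q : G) :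
    f (P + Q) = f P + f Q := by
  by_cases hPQ : P + Q ∈ Z
  · rw [hZ _ hPQ]
    by_cases hP : P ∈ Z
    · by_cases hQ : Q ∈ Z
      · rw [hZ _ hP, hZ _ hQ, add_zero]
      -- The pair is rearranged so that its sum is `Q`, which lies outside `Z`.
      · have h := hadd (P + Q) (-P) (by simpa using hQ)
        rw [hneg, hZ _ hPQ, add_neg_cancel_comm] at h
        rw [h]; simp
    · have h := hadd (P + Q) (-Q) (by simpa using hP)
      rw [hneg, hZ _ hPQ, add_neg_cancel_right] at h
      rw [h]; simp
  · exact hadd P Q hPQ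

section Derivation

variable {K : Type*} [Field K] (D : Derivation ℤ K K)

/-! ### The invariant differential of the quadratic twist -/

/-- The value `D(x) / y` of the invariant differential at a point of `A y² = x³ - x`, written in
the coordinates of the Weierstrass model. -/
def quadDiff (A : K) : (quadTwist A).toAffine.Point → K
  | .zero => 0
  | .some X Y _ => (A * D X - D A * X) / Y

theorem quadTwist_equation_iff (A X Y : K) :
    (quadTwist A).toAffine.Equation X Y ↔ Y ^ 2 = X ^ 3 - A ^ 2 * X := by
  rw [WeierstrassCurve.Affine.equation_iff]
  simp only [quadTwist]
  constructor <;> intro h <;> linear_combination h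

/-- Cross-multiplied forms of `D(x) = δ y` and of the differentiated curve equation. Being free of
division, they hold at `Y = 0` too and allow both `D X` and `D Y` to be eliminated in favour of `δ`.
-/
theorem quadDiff_spec {A X Y : K}
    (h : (quadTwist A).toAffine.Nonsingular X Y) :
    A * D X = D A * X + quadDiff D A (.some X Y h) * Y ∧
      2 * A * D Y = (3 * X ^ 2 - A ^ 2) * quadDiff D A (.some X Y h) + 3 * D A * Y := by
  have e := (quadTwist_equation_iff A X Y).1 h.1
  have de : 2 * Y * D Y = (3 * X ^ 2 - A ^ 2) * D X - 2 * A * D A * X := by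
    have := congrArg D e
    simp only [Derivation.leibniz_pow, Derivation.leibniz, map_sub, smul_eq_mul, nsmul_eq_mul,
      Nat.cast_ofNat, pow_one, Nat.add_one_sub_one] at this
    linear_combination this
  by_cases hY : Y = 0
  -- Here `X / A` is one of `0, 1, -1`, hence killed by `D`, so the value `0` of the division by
  -- zero is the correct one.
  · subst hY
    have hX : X * ((X - A) * (X + A)) = 0 := by linear_combination -e
    have : A * D X = D A * X := by
      rcases mul_eq_zero.1 hX with h | h
      · simp [h]
      · rcases mul_eq_zero.1 h with h | h
        · rw [sub_eq_zero.1 h, mul_comm]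
        · rw [eq_neg_of_add_eq_zero_left h, map_neg]; ring
    simp [quadDiff, this]
  · have h1 : A * D X = D A * X + quadDiff D A (.some X Y h) * Y := by
      simp only [quadDiff]; field_simp; ring
    refine ⟨h1, mul_left_cancel₀ hY ?_⟩
    linear_combination A * de + (3 * X ^ 2 - A ^ 2) * h1 - 3 * D A * e

theorem quadDiff_neg [DecidableEq K] (A : K) (P : (quadTwist A).toAffine.Point) :
    quadDiff D A (-P) = -quadDiff D A P := by
  rcases P with _ | ⟨X, Y, h⟩
  · change (0 : K) = -0; simp
  · rw [WeierstrassCurve.Affine.Point.neg_some]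
    simp only [quadDiff, WeierstrassCurve.Affine.negY, quadTwist]
    rw [← div_neg]; congr 1; ring

theorem quadDiff_chord {A X₁ Y₁ X₂ Y₂ L δ₁ δ₂ : K}
    (e₁ : Y₁ ^ 2 = X₁ ^ 3 - A ^ 2 * X₁) (e₂ : Y₂ ^ 2 = X₂ ^ 3 - A ^ 2 * X₂)
    (h₁ : A * D X₁ = D A * X₁ + δ₁ * Y₁) (h₂ : A * D X₂ = D A * X₂ + δ₂ * Y₂)
    (k₁ : 2 * A * D Y₁ = (3 * X₁ ^ 2 - A ^ 2) * δ₁ + 3 * D A * Y₁)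
    (k₂ : 2 * A * D Y₂ = (3 * X₂ ^ 2 - A ^ 2) * δ₂ + 3 * D A * Y₂)
    (hX : X₁ ≠ X₂) (hL : L * (X₁ - X₂) = Y₁ - Y₂) :
    A * D (L ^ 2 - X₁ - X₂) - D A * (L ^ 2 - X₁ - X₂) =
      (δ₁ + δ₂) * -(L * (L ^ 2 - X₁ - X₂ - X₁) + Y₁) := by
  have hu : X₁ - X₂ ≠ 0 := sub_ne_zero.2 hX
  have dL := congrArg D hL
  -- A second expression for the slope: the difference of the two curve equations divided by `X₁ -
  -- X₂`.
  have R : X₁ ^ 2 + X₁ * X₂ + X₂ ^ 2 - A ^ 2 = L * (Y₁ + Y₂) :=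
    mul_left_cancel₀ hu (by linear_combination e₂ - e₁ - (Y₁ + Y₂) * hL)
  simp only [Derivation.leibniz_pow, Derivation.leibniz, map_sub, smul_eq_mul, nsmul_eq_mul,
      Nat.cast_ofNat, pow_one, Nat.add_one_sub_one] at dL ⊢
  apply mul_left_cancel₀ hu
  linear_combination 2 * A * L * dL + L * (k₁ - k₂) - 2 * L ^ 2 * (h₁ - h₂) -
    (X₁ - X₂) * (h₁ + h₂) - 3 * L * D A * hL + (δ₁ * L ^ 2 + δ₂ * L ^ 2 - δ₂ * (X₁ - X₂)) * hL +
    (δ₁ - δ₂) * L * R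

theorem quadDiff_tangent {A X Y L δ : K} (h2 : (2 : K) ≠ 0)
    (h : A * D X = D A * X + δ * Y)
    (k : 2 * A * D Y = (3 * X ^ 2 - A ^ 2) * δ + 3 * D A * Y)
    (hY : Y ≠ 0) (hL : L * (2 * Y) = 3 * X ^ 2 - A ^ 2) :
    A * D (L ^ 2 - X - X) - D A * (L ^ 2 - X - X) =
      (δ + δ) * -(L * (L ^ 2 - X - X - X) + Y) := by
  have dL := congrArg D hL
  have d2 : D (2 : K) = 0 := by simpa using D.map_natCast 2
  have d3 : D (3 : K) = 0 := by simpa using D.map_natCast 3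
  simp only [Derivation.leibniz_pow, Derivation.leibniz, map_sub, smul_eq_mul, nsmul_eq_mul,
      Nat.cast_ofNat, pow_one, Nat.add_one_sub_one, d2, d3] at dL ⊢
  apply mul_left_cancel₀ (mul_ne_zero h2 hY)
  linear_combination 2 * A * L * dL + 12 * X * L * h - 2 * L ^ 2 * k - 4 * Y * h +
    (2 * L ^ 2 * δ - 4 * L * D A) * hL

theorem quadDiff_add [DecidableEq K] {A : K} (h2 : (2 : K) ≠ 0)
    (P Q : (quadTwist A).toAffine.Point) :
    quadDiff D A (P + Q) = quadDiff D A P + quadDiff D A Q := by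
  -- The exceptional set consists of `O` (vacuously) and the points with `Y = 0`. Off it, the
  -- denominator of the differential at the sum can be cleared.
  refine map_add_of_off_set (quadDiff D A)
    {P | ∀ X Y h, P = .some X Y h → Y = 0} (quadDiff_neg D A) ?_ ?_ P Q
  · rintro (_ | ⟨X, Y, h⟩) hP
    · rfl
    · simp [quadDiff, hP X Y h rfl]
  · rintro (_ | ⟨X₁, Y₁, h₁⟩) (_ | ⟨X₂, Y₂, h₂⟩) hPQ
    · exact absurd (fun X Y h e => by simp [← WeierstrassCurve.Affine.Point.zero_def] at e) hPQ
    · rw [← WeierstrassCurve.Affine.Point.zero_def, zero_add]; simp [quadDiff]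
    · rw [← WeierstrassCurve.Affine.Point.zero_def, add_zero]; simp [quadDiff]
    · by_cases hxy : X₁ = X₂ ∧ Y₁ = (quadTwist A).toAffine.negY X₂ Y₂
      · exact absurd (fun X Y h e => by
          rw [WeierstrassCurve.Affine.Point.add_of_Y_eq hxy.1 hxy.2] at e
          simp at e) hPQ
      rw [WeierstrassCurve.Affine.Point.add_some hxy] at hPQ ⊢
      obtain ⟨e₁, k₁⟩ := quadDiff_spec D h₁
      obtain ⟨e₂, k₂⟩ := quadDiff_spec D h₂
      generalize quadDiff D A (.some X₁ Y₁ h₁) = δ₁ at *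
      generalize quadDiff D A (.some X₂ Y₂ h₂) = δ₂ at *
      have c₁ := (quadTwist_equation_iff A X₁ Y₁).1 h₁.1
      have c₂ := (quadTwist_equation_iff A X₂ Y₂).1 h₂.1
      have key : A * D ((quadTwist A).toAffine.slope X₁ X₂ Y₁ Y₂ ^ 2 - X₁ - X₂) -
          D A * ((quadTwist A).toAffine.slope X₁ X₂ Y₁ Y₂ ^ 2 - X₁ - X₂) =
          (δ₁ + δ₂) * -((quadTwist A).toAffine.slope X₁ X₂ Y₁ Y₂ *
            ((quadTwist A).toAffine.slope X₁ X₂ Y₁ Y₂ ^ 2 - X₁ - X₂ - X₁) + Y₁) := by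
        by_cases hX : X₁ = X₂
        · have hY : Y₁ ≠ (quadTwist A).toAffine.negY X₂ Y₂ := fun h => hxy ⟨hX, h⟩
          have hYY := WeierstrassCurve.Affine.Y_eq_of_Y_ne h₁.1 h₂.1 hX hY
          subst hX hYY
          have hs := WeierstrassCurve.Affine.slope_of_Y_ne rfl hY
          simp only [WeierstrassCurve.Affine.negY, quadTwist] at hs hY
          have hY0 : Y₁ ≠ 0 := fun h => hY (by simp [h])
          have hδ : δ₁ = δ₂ := mul_right_cancel₀ hY0 (by linear_combination e₂ - e₁)
          subst hδ
          refine quadDiff_tangent D h2 e₁ k₁ hY0 ?_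
          have : Y₁ - (-Y₁ - 0 * X₁ - 0) ≠ 0 := sub_ne_zero.2 hY
          rw [eq_div_iff this] at hs
          simp only [quadTwist]
          linear_combination hs
        · refine quadDiff_chord D c₁ c₂ e₁ e₂ k₁ k₂ hX ?_
          rw [WeierstrassCurve.Affine.slope_of_X_ne hX,
            div_mul_cancel₀ _ (sub_ne_zero.2 hX)]
      have hY3 : (quadTwist A).toAffine.addY X₁ X₂ Y₁
          ((quadTwist A).toAffine.slope X₁ X₂ Y₁ Y₂) ≠ 0 := by
        intro h0
        refine hPQ fun X Y h e => ?_
        rw [WeierstrassCurve.Affine.Point.some.injEq] at e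
        rw [← e.2, h0]
      simp only [quadDiff]
      rw [div_eq_iff hY3]
      clear hPQ
      generalize (quadTwist A).toAffine.slope X₁ X₂ Y₁ Y₂ = L at *
      have hx : (quadTwist A).toAffine.addX X₁ X₂ L = L ^ 2 - X₁ - X₂ := by
        simp only [WeierstrassCurve.Affine.addX, quadTwist]; ring
      have hy : (quadTwist A).toAffine.addY X₁ X₂ Y₁ L =
          -(L * (L ^ 2 - X₁ - X₂ - X₁) + Y₁) := by
        simp only [WeierstrassCurve.Affine.addY, WeierstrassCurve.Affine.negAddY,
          WeierstrassCurve.Affine.negY, hx]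
        simp only [quadTwist]; ring
      rw [hx, hy]
      exact key

end Derivation

section Derivation

variable {K : Type*} [Field K] (D : Derivation ℤ K K)

/-! ### The invariant differential of the cubic twist -/

/-- The value `D(y) / x²` of the invariant differential at a point of `y² - y = A x³`, written in
the coordinates of the Weierstrass model. -/
def cubicDiff (A : K) : (cubicTwist A).toAffine.Point → K
  | .zero => 0
  | .some X Y _ => (A * D Y - D A * Y) / X ^ 2

theorem cubicTwist_equation_iff (A X Y : K) :
    (cubicTwist A).toAffine.Equation X Y ↔ Y ^ 2 - A * Y = X ^ 3 := by
  rw [WeierstrassCurve.Affine.equation_iff]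
  simp only [cubicTwist]
  constructor <;> intro h <;> linear_combination h

theorem cubicDiff_spec {A X Y : K} (h : (cubicTwist A).toAffine.Nonsingular X Y) :
    A * D Y = D A * Y + cubicDiff D A (.some X Y h) * X ^ 2 ∧
      3 * A * D X = (2 * Y - A) * cubicDiff D A (.some X Y h) + 2 * D A * X := by
  have e := (cubicTwist_equation_iff A X Y).1 h.1
  have de : (2 * Y - A) * D Y - D A * Y = 3 * X ^ 2 * D X := by
    have := congrArg D e
    simp only [Derivation.leibniz_pow, Derivation.leibniz, map_sub, smul_eq_mul, nsmul_eq_mul,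
      Nat.cast_ofNat, pow_one, Nat.add_one_sub_one] at this
    linear_combination this
  by_cases hX : X = 0
  · subst hX
    have hY : Y * (Y - A) = 0 := by linear_combination e
    have : A * D Y = D A * Y := by
      rcases mul_eq_zero.1 hY with h | h
      · simp [h]
      · rw [sub_eq_zero.1 h, mul_comm]
    simp [cubicDiff, this]
  · have h1 : A * D Y = D A * Y + cubicDiff D A (.some X Y h) * X ^ 2 := by
      simp only [cubicDiff]; field_simp; ring
    refine ⟨h1, mul_left_cancel₀ (pow_ne_zero 2 hX) ?_⟩
    linear_combination -A * de + (2 * Y - A) * h1 + 2 * D A * e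

theorem cubicDiff_neg [DecidableEq K] (A : K) (P : (cubicTwist A).toAffine.Point) :
    cubicDiff D A (-P) = -cubicDiff D A P := by
  rcases P with _ | ⟨X, Y, h⟩
  · change (0 : K) = -0; simp
  · rw [WeierstrassCurve.Affine.Point.neg_some]
    simp only [cubicDiff, WeierstrassCurve.Affine.negY, cubicTwist, map_sub, map_neg,
      Derivation.leibniz, smul_eq_mul, map_zero]
    rw [← neg_div]; congr 1; ring

theorem cubicDiff_chord {A X₁ Y₁ X₂ Y₂ L δ₁ δ₂ : K} (h3 : (3 : K) ≠ 0)
    (c₁ : Y₁ ^ 2 - A * Y₁ = X₁ ^ 3) (c₂ : Y₂ ^ 2 - A * Y₂ = X₂ ^ 3)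
    (h₁ : A * D Y₁ = D A * Y₁ + δ₁ * X₁ ^ 2) (h₂ : A * D Y₂ = D A * Y₂ + δ₂ * X₂ ^ 2)
    (k₁ : 3 * A * D X₁ = (2 * Y₁ - A) * δ₁ + 2 * D A * X₁)
    (k₂ : 3 * A * D X₂ = (2 * Y₂ - A) * δ₂ + 2 * D A * X₂)
    (hX : X₁ ≠ X₂) (hL : L * (X₁ - X₂) = Y₁ - Y₂) :
    A * D (A - (L * (L ^ 2 - X₁ - X₂ - X₁) + Y₁)) - D A * (A - (L * (L ^ 2 - X₁ - X₂ - X₁) + Y₁)) =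
      (δ₁ + δ₂) * (L ^ 2 - X₁ - X₂) ^ 2 := by
  have hu : X₁ - X₂ ≠ 0 := sub_ne_zero.2 hX
  have dL := congrArg D hL
  have R : X₁ ^ 2 + X₁ * X₂ + X₂ ^ 2 = L * (Y₁ + Y₂ - A) :=
    mul_left_cancel₀ hu (by linear_combination c₂ - c₁ - (Y₁ + Y₂ - A) * hL)
  -- Once all derivatives are eliminated, `r₁` and `r₂` are the coefficients of `δ₁` and `δ₂`; each
  -- vanishes separately by the slope relations.
  have r₁ : -(3 * L ^ 2 - 2 * X₁ - X₂) * 3 * X₁ ^ 2 +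
      (3 * L ^ 2 - 2 * X₁ - X₂) * L * (2 * Y₁ - A) + 2 * (X₁ - X₂) * L * (2 * Y₁ - A) -
      3 * (X₁ - X₂) * X₁ ^ 2 - 3 * (X₁ - X₂) * (L ^ 2 - X₁ - X₂) ^ 2 = 0 := by
    clear dL h₁ h₂ k₁ k₂ c₁ c₂; grind
  have r₂ : (3 * L ^ 2 - 2 * X₁ - X₂) * 3 * X₂ ^ 2 -
      (3 * L ^ 2 - 2 * X₁ - X₂) * L * (2 * Y₂ - A) + (X₁ - X₂) * L * (2 * Y₂ - A) -
      3 * (X₁ - X₂) * (L ^ 2 - X₁ - X₂) ^ 2 = 0 := by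
    clear dL h₁ h₂ k₁ k₂ c₁ c₂; grind
  simp only [Derivation.leibniz_pow, Derivation.leibniz, map_sub, map_add, smul_eq_mul,
    nsmul_eq_mul, Nat.cast_ofNat, pow_one, Nat.add_one_sub_one] at dL ⊢
  apply mul_left_cancel₀ (mul_ne_zero h3 hu)
  linear_combination -3 * A * (3 * L ^ 2 - 2 * X₁ - X₂) * dL -
    3 * (3 * L ^ 2 - 2 * X₁ - X₂) * (h₁ - h₂) - 3 * (X₁ - X₂) * h₁ +
    (3 * L ^ 2 - 2 * X₁ - X₂) * L * (k₁ - k₂) + (X₁ - X₂) * L * (2 * k₁ + k₂) +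
    3 * (3 * L ^ 2 - 2 * X₁ - X₂) * D A * hL + δ₁ * r₁ + δ₂ * r₂

theorem cubicDiff_tangent {A X Y L δ : K} (h3 : (3 : K) ≠ 0)
    (h : A * D Y = D A * Y + δ * X ^ 2)
    (k : 3 * A * D X = (2 * Y - A) * δ + 2 * D A * X)
    (hM : 2 * Y - A ≠ 0) (hL : L * (2 * Y - A) = 3 * X ^ 2) :
    A * D (A - (L * (L ^ 2 - X - X - X) + Y)) - D A * (A - (L * (L ^ 2 - X - X - X) + Y)) =
      (δ + δ) * (L ^ 2 - X - X) ^ 2 := by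
  have dL := congrArg D hL
  have d2 : D (2 : K) = 0 := by simpa using D.map_natCast 2
  have d3 : D (3 : K) = 0 := by simpa using D.map_natCast 3
  have r : (-18 * X * (L ^ 2 - X) + 3 * L * (2 * Y - A)) * (2 * Y - A) +
      (18 * L * (L ^ 2 - X) - 3 * (2 * Y - A)) * X ^ 2 -
      6 * (2 * Y - A) * (L ^ 2 - X - X) ^ 2 = 0 := by
    generalize 2 * Y - A = M at *
    clear dL h k; grind
  simp only [Derivation.leibniz_pow, Derivation.leibniz, map_sub, map_add, smul_eq_mul,
    nsmul_eq_mul, Nat.cast_ofNat, pow_one, Nat.add_one_sub_one, d2, d3] at dL ⊢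
  apply mul_left_cancel₀ (mul_ne_zero h3 hM)
  linear_combination -9 * A * (L ^ 2 - X) * dL +
    (18 * L * (L ^ 2 - X) - 3 * (2 * Y - A)) * h +
    (-18 * X * (L ^ 2 - X) + 3 * L * (2 * Y - A)) * k + 12 * (L ^ 2 - X) * D A * hL + δ * r

theorem cubicDiff_add [DecidableEq K] {A : K} (h3 : (3 : K) ≠ 0)
    (P Q : (cubicTwist A).toAffine.Point) :
    cubicDiff D A (P + Q) = cubicDiff D A P + cubicDiff D A Q := by
  refine map_add_of_off_set (cubicDiff D A)
    {P | ∀ X Y h, P = .some X Y h → X = 0} (cubicDiff_neg D A) ?_ ?_ P Q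
  · rintro (_ | ⟨X, Y, h⟩) hP
    · rfl
    · simp [cubicDiff, hP X Y h rfl]
  · rintro (_ | ⟨X₁, Y₁, h₁⟩) (_ | ⟨X₂, Y₂, h₂⟩) hPQ
    · exact absurd (fun X Y h e => by simp [← WeierstrassCurve.Affine.Point.zero_def] at e) hPQ
    · rw [← WeierstrassCurve.Affine.Point.zero_def, zero_add]; simp [cubicDiff]
    · rw [← WeierstrassCurve.Affine.Point.zero_def, add_zero]; simp [cubicDiff]
    · by_cases hxy : X₁ = X₂ ∧ Y₁ = (cubicTwist A).toAffine.negY X₂ Y₂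
      · exact absurd (fun X Y h e => by
          rw [WeierstrassCurve.Affine.Point.add_of_Y_eq hxy.1 hxy.2] at e
          simp at e) hPQ
      rw [WeierstrassCurve.Affine.Point.add_some hxy] at hPQ ⊢
      obtain ⟨e₁, k₁⟩ := cubicDiff_spec D h₁
      obtain ⟨e₂, k₂⟩ := cubicDiff_spec D h₂
      -- Recorded before the values are generalized: when `X₁ = X₂ = 0` the relations `e₁`, `e₂` no
      -- longer determine `δ₁`, `δ₂`.
      have hδ : X₁ = X₂ → Y₁ = Y₂ →
          cubicDiff D A (.some X₁ Y₁ h₁) = cubicDiff D A (.some X₂ Y₂ h₂) := by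
        rintro rfl rfl; rfl
      generalize cubicDiff D A (.some X₁ Y₁ h₁) = δ₁ at *
      generalize cubicDiff D A (.some X₂ Y₂ h₂) = δ₂ at *
      have c₁ := (cubicTwist_equation_iff A X₁ Y₁).1 h₁.1
      have c₂ := (cubicTwist_equation_iff A X₂ Y₂).1 h₂.1
      have hX3 : (cubicTwist A).toAffine.addX X₁ X₂
          ((cubicTwist A).toAffine.slope X₁ X₂ Y₁ Y₂) ≠ 0 := by
        intro h0
        refine hPQ fun X Y h e => ?_
        rw [WeierstrassCurve.Affine.Point.some.injEq] at e
        rw [← e.1, h0]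
      clear hPQ
      simp only [cubicDiff]
      rw [div_eq_iff (pow_ne_zero 2 hX3)]
      have hx (L : K) : (cubicTwist A).toAffine.addX X₁ X₂ L = L ^ 2 - X₁ - X₂ := by
        simp only [WeierstrassCurve.Affine.addX, cubicTwist]; ring
      have hy (L : K) : (cubicTwist A).toAffine.addY X₁ X₂ Y₁ L =
          A - (L * (L ^ 2 - X₁ - X₂ - X₁) + Y₁) := by
        simp only [WeierstrassCurve.Affine.addY, WeierstrassCurve.Affine.negAddY,
          WeierstrassCurve.Affine.negY, hx]
        simp only [cubicTwist]; ring
      rw [hx, hy]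
      by_cases hX : X₁ = X₂
      · have hY : Y₁ ≠ (cubicTwist A).toAffine.negY X₂ Y₂ := fun h => hxy ⟨hX, h⟩
        have hYY := WeierstrassCurve.Affine.Y_eq_of_Y_ne h₁.1 h₂.1 hX hY
        obtain rfl := hδ hX hYY
        subst hX hYY
        have hs := WeierstrassCurve.Affine.slope_of_Y_ne rfl hY
        have hM : Y₁ - (cubicTwist A).toAffine.negY X₁ Y₁ = 2 * Y₁ - A := by
          simp only [WeierstrassCurve.Affine.negY, cubicTwist]; ring
        have hM0 : 2 * Y₁ - A ≠ 0 := hM ▸ sub_ne_zero.2 hY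
        refine cubicDiff_tangent D h3 e₁ k₁ hM0 ?_
        rw [hM, eq_div_iff hM0] at hs
        rw [hs]
        simp only [cubicTwist]
        ring
      · refine cubicDiff_chord D h3 c₁ c₂ e₁ e₂ k₁ k₂ hX ?_
        rw [WeierstrassCurve.Affine.slope_of_X_ne hX,
          div_mul_cancel₀ _ (sub_ne_zero.2 hX)]

end Derivation

/-! ### Duplication formulas -/

section Duplication

variable {K : Type*} [Field K] [DecidableEq K]

/-- The duplication formula `x(2P) = (x² + 1)² / (4 (x³ - x))` on the quadratic twist. -/
theorem quadTwist_two_nsmul {A X Y : K} (h : (quadTwist A).toAffine.Nonsingular X Y)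
    (h0 : (2 : ℕ) • WeierstrassCurve.Affine.Point.some X Y h ≠ 0) :
    Y ≠ 0 ∧ ∃ X' Y' h', (2 : ℕ) • WeierstrassCurve.Affine.Point.some X Y h = .some X' Y' h' ∧
      4 * (X ^ 3 - A ^ 2 * X) * X' = (X ^ 2 + A ^ 2) ^ 2 := by
  have e := (quadTwist_equation_iff A X Y).1 h.1
  have hY : Y ≠ (quadTwist A).toAffine.negY X Y := fun hY =>
    h0 (by rw [two_nsmul, WeierstrassCurve.Affine.Point.add_self_of_Y_eq hY])
  have hM : Y - (quadTwist A).toAffine.negY X Y = 2 * Y := by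
    simp only [WeierstrassCurve.Affine.negY, quadTwist]; ring
  have hM0 : 2 * Y ≠ 0 := hM ▸ sub_ne_zero.2 hY
  refine ⟨right_ne_zero_of_mul hM0, _, _, _,
    by rw [two_nsmul, WeierstrassCurve.Affine.Point.add_self_of_Y_ne hY], ?_⟩
  have hs := WeierstrassCurve.Affine.slope_of_Y_ne rfl hY
  rw [hM, eq_div_iff hM0] at hs
  generalize (quadTwist A).toAffine.slope X X Y Y = L at *
  simp only [WeierstrassCurve.Affine.addX, quadTwist] at hs ⊢
  have hs' : L * (2 * Y) = 3 * X ^ 2 - A ^ 2 := by linear_combination hs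
  linear_combination -4 * L ^ 2 * e + (L * (2 * Y) + (3 * X ^ 2 - A ^ 2)) * hs'

/-- The duplication formula `y(2P) = (y - 1) (y + 1)³ / (2 y - 1)³` on the cubic twist. -/
theorem cubicTwist_two_nsmul {A X Y : K} (h : (cubicTwist A).toAffine.Nonsingular X Y)
    (h0 : (2 : ℕ) • WeierstrassCurve.Affine.Point.some X Y h ≠ 0) :
    2 * Y - A ≠ 0 ∧
      ∃ X' Y' h', (2 : ℕ) • WeierstrassCurve.Affine.Point.some X Y h = .some X' Y' h' ∧
        (2 * Y - A) ^ 3 * Y' = (Y - A) * (Y + A) ^ 3 := by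
  have e := (cubicTwist_equation_iff A X Y).1 h.1
  have hY : Y ≠ (cubicTwist A).toAffine.negY X Y := fun hY =>
    h0 (by rw [two_nsmul, WeierstrassCurve.Affine.Point.add_self_of_Y_eq hY])
  have hM : Y - (cubicTwist A).toAffine.negY X Y = 2 * Y - A := by
    simp only [WeierstrassCurve.Affine.negY, cubicTwist]; ring
  have hM0 : 2 * Y - A ≠ 0 := hM ▸ sub_ne_zero.2 hY
  refine ⟨hM0, _, _, _,
    by rw [two_nsmul, WeierstrassCurve.Affine.Point.add_self_of_Y_ne hY], ?_⟩
  have hs := WeierstrassCurve.Affine.slope_of_Y_ne rfl hY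
  rw [hM, eq_div_iff hM0] at hs
  generalize (cubicTwist A).toAffine.slope X X Y Y = L at *
  simp only [WeierstrassCurve.Affine.addX, WeierstrassCurve.Affine.addY,
    WeierstrassCurve.Affine.negAddY, WeierstrassCurve.Affine.negY, cubicTwist] at hs ⊢
  have hs' : L * (2 * Y - A) = 3 * X ^ 2 := by linear_combination hs
  have h1 : (L * (2 * Y - A)) ^ 3 = 27 * X ^ 6 := by rw [hs']; ring
  have h2 : L * (2 * Y - A) ^ 3 * X = 3 * X ^ 3 * (2 * Y - A) ^ 2 := by
    linear_combination X * (2 * Y - A) ^ 2 * hs'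
  have h3 : X ^ 6 = (Y ^ 2 - A * Y) ^ 2 := by rw [e]; ring
  linear_combination -h1 + 3 * h2 - 27 * h3 - 9 * (2 * Y - A) ^ 2 * e

end Duplication

variable {F : Type*} [Field F]

/-! ### The derivation `d/dt` on rational functions -/

section RatFuncDerivation

/-- The derivative of a rational function, by the quotient rule. -/
def ratDerivFun (x : RatFunc F) : RatFunc F :=
  algebraMap F[X] (RatFunc F) (derivative x.num * x.denom - x.num * derivative x.denom) /
    algebraMap F[X] (RatFunc F) x.denom ^ 2

/-- Differentiating the cross-multiplied equality of two fractions shows that the quotient rule does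
not depend on the fraction chosen. Sums and products can thus be differentiated without reduction to
lowest terms. -/
theorem ratDerivFun_div (p : F[X]) {q : F[X]} (hq : q ≠ 0) :
    ratDerivFun (algebraMap F[X] (RatFunc F) p / algebraMap F[X] (RatFunc F) q) =
      algebraMap F[X] (RatFunc F) (derivative p * q - p * derivative q) /
        algebraMap F[X] (RatFunc F) q ^ 2 := by
  set x := algebraMap F[X] (RatFunc F) p / algebraMap F[X] (RatFunc F) q with hx
  have h := (RatFunc.num_mul_eq_mul_denom_iff hq).2 hx
  have hd := congrArg derivative h
  rw [derivative_mul, derivative_mul] at hd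
  have hxd := RatFunc.denom_ne_zero x
  rw [ratDerivFun, div_eq_div_iff (pow_ne_zero 2 (RatFunc.algebraMap_ne_zero hxd))
    (pow_ne_zero 2 (RatFunc.algebraMap_ne_zero hq)), ← map_pow, ← map_pow, ← map_mul, ← map_mul]
  congr 1
  linear_combination q * x.denom * hd - (derivative x.denom * q + x.denom * derivative q) * h

theorem ratDerivFun_add (x y : RatFunc F) :
    ratDerivFun (x + y) = ratDerivFun x + ratDerivFun y := by
  have hx := RatFunc.denom_ne_zero x
  have hy := RatFunc.denom_ne_zero y
  have hx' := RatFunc.algebraMap_ne_zero hx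
  have hy' := RatFunc.algebraMap_ne_zero hy
  have h : x + y = algebraMap F[X] (RatFunc F) (x.num * y.denom + x.denom * y.num) /
      algebraMap F[X] (RatFunc F) (x.denom * y.denom) := by
    nth_rw 1 [← RatFunc.num_div_denom x, ← RatFunc.num_div_denom y]
    simp only [map_mul, map_add]
    field_simp
  rw [h, ratDerivFun_div _ (mul_ne_zero hx hy), ratDerivFun, ratDerivFun]
  simp only [map_mul, map_add, map_sub, derivative_mul]
  field_simp
  ring

theorem ratDerivFun_mul (x y : RatFunc F) :
    ratDerivFun (x * y) = x * ratDerivFun y + y * ratDerivFun x := by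
  have hx := RatFunc.denom_ne_zero x
  have hy := RatFunc.denom_ne_zero y
  have hx' := RatFunc.algebraMap_ne_zero hx
  have hy' := RatFunc.algebraMap_ne_zero hy
  have h : x * y = algebraMap F[X] (RatFunc F) (x.num * y.num) /
      algebraMap F[X] (RatFunc F) (x.denom * y.denom) := by
    nth_rw 1 [← RatFunc.num_div_denom x, ← RatFunc.num_div_denom y]
    simp only [map_mul]
    field_simp
  have key : algebraMap F[X] (RatFunc F) x.num / algebraMap F[X] (RatFunc F) x.denom *
        ratDerivFun y + algebraMap F[X] (RatFunc F) y.num / algebraMap F[X] (RatFunc F) y.denom *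
        ratDerivFun x = ratDerivFun (x * y) := by
    rw [h, ratDerivFun_div _ (mul_ne_zero hx hy), ratDerivFun, ratDerivFun]
    simp only [map_mul, map_add, map_sub, derivative_mul]
    field_simp
    ring
  rw [← key, RatFunc.num_div_denom, RatFunc.num_div_denom]

/-- An additive map satisfying the Leibniz rule, as a derivation over `ℤ`. -/
def derivationOfLeibniz {K : Type*} [Field K] (f : K → K) (hadd : ∀ x y, f (x + y) = f x + f y)
    (hmul : ∀ x y, f (x * y) = x * f y + y * f x) : Derivation ℤ K K :=
  Derivation.mk' (AddMonoidHom.toIntLinearMap (AddMonoidHom.mk' f hadd)) hmul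

variable (F) in
/-- The derivation `d/dt` on rational functions. -/
def ratDeriv :=
  derivationOfLeibniz (K := RatFunc F) ratDerivFun ratDerivFun_add ratDerivFun_mul

@[simp]
theorem ratDeriv_algebraMap (p : F[X]) :
    ratDeriv F (algebraMap F[X] (RatFunc F) p) = algebraMap F[X] (RatFunc F) (derivative p) := by
  have := ratDerivFun_div p (one_ne_zero (α := F[X]))
  simp only [map_one, div_one, derivative_one, mul_zero, sub_zero, mul_one, one_pow] at this
  exact this

end RatFuncDerivation

/-! ### Heights of rational functions -/

section Height

/-- The height of a rational function: its degree as a map to the projective line. -/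
def ratHeight (x : RatFunc F) : ℕ := max x.num.natDegree x.denom.natDegree

/-- Two coprime representations of a fraction differ by a unit, so the degrees agree. -/
theorem ratHeight_div {a b : F[X]} (hab : IsCoprime a b) (hb : b ≠ 0) :
    ratHeight (algebraMap F[X] (RatFunc F) a / algebraMap F[X] (RatFunc F) b) =
      max a.natDegree b.natDegree := by
  set x := algebraMap F[X] (RatFunc F) a / algebraMap F[X] (RatFunc F) b with hx
  have h := (RatFunc.num_mul_eq_mul_denom_iff hb).2 hx
  have hc := RatFunc.isCoprime_num_denom x
  have h1 : Associated x.num a := associated_of_dvd_dvd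
    (hc.dvd_of_dvd_mul_right (Dvd.intro _ h)) (hab.dvd_of_dvd_mul_right (Dvd.intro _ h.symm))
  have h2 : Associated x.denom b := associated_of_dvd_dvd
    (hc.symm.dvd_of_dvd_mul_left (Dvd.intro_left _ h.symm))
    (hab.symm.dvd_of_dvd_mul_left (Dvd.intro_left _ h))
  rw [ratHeight, natDegree_eq_of_degree_eq (degree_eq_degree_of_associated h1),
    natDegree_eq_of_degree_eq (degree_eq_degree_of_associated h2)]

theorem exists_C_of_ratHeight_eq_zero {x : RatFunc F} (hx : ratHeight x = 0) :
    ∃ c : F, x = algebraMap F[X] (RatFunc F) (C c) := by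
  obtain ⟨h1, h2⟩ : x.num.natDegree = 0 ∧ x.denom.natDegree = 0 := by
    rw [ratHeight] at hx; omega
  have h3 := eq_one_of_monic_natDegree_zero (RatFunc.monic_denom x) h2
  refine ⟨x.num.coeff 0, ?_⟩
  rw [← eq_C_of_natDegree_eq_zero h1]
  conv_lhs => rw [← RatFunc.num_div_denom x, h3, map_one, div_one]

/-- The polynomial `p` has degree at most `n`, with coefficient `c` in degree `n`. -/
def IsTopCoeff (p : F[X]) (n : ℕ) (c : F) : Prop := p.natDegree ≤ n ∧ p.coeff n = c

theorem IsTopCoeff.add {p q : F[X]} {n : ℕ} {c d : F} (hp : IsTopCoeff p n c)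
    (hq : IsTopCoeff q n d) : IsTopCoeff (p + q) n (c + d) :=
  ⟨natDegree_add_le_of_degree_le hp.1 hq.1, by rw [coeff_add, hp.2, hq.2]⟩

theorem IsTopCoeff.sub {p q : F[X]} {n : ℕ} {c d : F} (hp : IsTopCoeff p n c)
    (hq : IsTopCoeff q n d) : IsTopCoeff (p - q) n (c - d) :=
  ⟨natDegree_sub_le_of_le hp.1 hq.1 |>.trans (max_self n).le, by rw [coeff_sub, hp.2, hq.2]⟩

theorem IsTopCoeff.mul {p q : F[X]} {n m : ℕ} {c d : F} (hp : IsTopCoeff p n c)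
    (hq : IsTopCoeff q m d) : IsTopCoeff (p * q) (n + m) (c * d) :=
  ⟨natDegree_mul_le_of_le hp.1 hq.1, by
    rw [coeff_mul_add_eq_of_natDegree_le hp.1 hq.1, hp.2, hq.2]⟩

theorem IsTopCoeff.pow {p : F[X]} {n : ℕ} {c : F} (hp : IsTopCoeff p n c) (m : ℕ) :
    IsTopCoeff (p ^ m) (m * n) (c ^ m) :=
  ⟨natDegree_pow_le_of_le m hp.1, by rw [coeff_pow_of_natDegree_le hp.1, hp.2]⟩

theorem IsTopCoeff.C_mul {p : F[X]} {n : ℕ} {c : F} (hp : IsTopCoeff p n c) (r : F) :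
    IsTopCoeff (C r * p) n (r * c) :=
  ⟨(natDegree_C_mul_le _ _).trans hp.1, by rw [coeff_C_mul, hp.2]⟩

theorem IsTopCoeff.max_natDegree {p q : F[X]} {n : ℕ} {c d : F} (hp : IsTopCoeff p n c)
    (hq : IsTopCoeff q n d) (h : c ≠ 0 ∨ d ≠ 0) : max p.natDegree q.natDegree = n := by
  refine le_antisymm (max_le hp.1 hq.1) ?_
  rcases h with h | h
  · exact le_max_of_le_left (le_natDegree_of_ne_zero (hp.2 ▸ h))
  · exact le_max_of_le_right (le_natDegree_of_ne_zero (hq.2 ▸ h))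

/-- The pair `(α : β)` is the value of `a / b` at infinity in homogeneous coordinates; one of the
two may vanish, but not both. -/
theorem exists_isTopCoeff_max {a b : F[X]} (hb : b ≠ 0) :
    ∃ α β, IsTopCoeff a (max a.natDegree b.natDegree) α ∧
      IsTopCoeff b (max a.natDegree b.natDegree) β ∧ ¬ (α = 0 ∧ β = 0) := by
  refine ⟨_, _, ⟨le_max_left _ _, rfl⟩, ⟨le_max_right _ _, rfl⟩, ?_⟩
  rintro ⟨h1, h2⟩
  rcases le_total a.natDegree b.natDegree with h | h
  · rw [max_eq_right h] at h2
    exact hb (leadingCoeff_eq_zero.1 h2)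
  · rw [max_eq_left h] at h1 h2
    rw [leadingCoeff_eq_zero.1 h1, natDegree_zero, Nat.le_zero] at h
    rw [leadingCoeff_eq_zero.1 h1, natDegree_zero, ← h] at h2
    exact hb (leadingCoeff_eq_zero.1 h2)

/-- Duplication acts on `x` as a self-map of the projective line of degree 4. For `x = a/b`, the
forms `(a² + b²)²` and `4ab(a² - b²)` have no common zero when `2 ≠ 0`, neither at a prime nor at
infinity, so no cancellation lowers the degree. -/
theorem ratHeight_quad_duplication (h2 : (2 : F) ≠ 0) {x x' : RatFunc F} (hx : x ^ 3 - x ≠ 0)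
    (h : 4 * (x ^ 3 - x) * x' = (x ^ 2 + 1) ^ 2) : ratHeight x' = 4 * ratHeight x := by
  have hb := RatFunc.denom_ne_zero x
  have hab := RatFunc.isCoprime_num_denom x
  have hxe := RatFunc.num_div_denom x
  rw [show ratHeight x = max x.num.natDegree x.denom.natDegree from rfl]
  generalize x.num = a at *
  generalize x.denom = b at *
  have hb' := RatFunc.algebraMap_ne_zero hb
  have h4 : (4 : F) ≠ 0 := by
    rw [show (4 : F) = 2 * 2 by norm_num]; exact mul_ne_zero h2 h2
  have hu : ∀ p : F[X], Prime p → ∀ {c : F} {q : F[X]}, c ≠ 0 → p ∣ C c * q → p ∣ q :=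
    fun p hp c q hc h => (hp.dvd_or_dvd h).resolve_left fun h =>
      hp.not_isUnit (isUnit_of_dvd_unit h (isUnit_C.2 hc.isUnit))
  have hnot : ∀ p : F[X], Prime p → p ∣ a → p ∣ b → False := fun p hp ha hb =>
    hp.not_isUnit (hab.isUnit_of_dvd' ha hb)
  have hden : C 4 * (a * b * ((a - b) * (a + b))) ≠ 0 := by
    refine mul_ne_zero (C_ne_zero.2 h4) fun h0 => hx ?_
    rw [← hxe, div_pow]
    field_simp
    rw [mul_zero, ← map_pow, ← map_pow, ← map_sub,
      show a ^ 2 - b ^ 2 = (a - b) * (a + b) by ring]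
    rcases mul_eq_zero.1 h0 with h0 | h0
    · have ha : a = 0 := (mul_eq_zero.1 h0).resolve_right hb
      simp [ha]
    · simp [h0]
  have hcop : IsCoprime ((a * a + b * b) * (a * a + b * b))
      (C 4 * (a * b * ((a - b) * (a + b)))) := by
    refine isCoprime_of_prime_dvd (fun h => hden h.2) fun p hp h1 h3 => ?_
    have h1 : p ∣ a * a + b * b := (hp.dvd_or_dvd h1).elim id id
    -- A common prime factor of `a² + b²` and `a² - b²` divides `2a²` and `2b²`.
    have key : p ∣ (a - b) * (a + b) → False := fun h => by
      have e1 : p ∣ C 2 * (a * a) := by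
        have := dvd_add h1 h
        rwa [show a * a + b * b + (a - b) * (a + b) = C 2 * (a * a) by
          rw [show (C 2 : F[X]) = 2 from rfl]; ring] at this
      have e2 : p ∣ C 2 * (b * b) := by
        have := dvd_sub h1 h
        rwa [show a * a + b * b - (a - b) * (a + b) = C 2 * (b * b) by
          rw [show (C 2 : F[X]) = 2 from rfl]; ring] at this
      exact hnot p hp ((hp.dvd_or_dvd (hu p hp h2 e1)).elim id id)
        ((hp.dvd_or_dvd (hu p hp h2 e2)).elim id id)
    rcases hp.dvd_or_dvd (hu p hp h4 h3) with h3 | h3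
    · rcases hp.dvd_or_dvd h3 with h3 | h3
      · exact hnot p hp h3 ((hp.dvd_or_dvd
          ((dvd_add_right (h3.mul_right a)).1 h1)).elim id id)
      · exact hnot p hp ((hp.dvd_or_dvd
          ((dvd_add_left (h3.mul_right b)).1 h1)).elim id id) h3
    · exact key h3
  have hx' : x' = algebraMap F[X] (RatFunc F) ((a * a + b * b) * (a * a + b * b)) /
      algebraMap F[X] (RatFunc F) (C 4 * (a * b * ((a - b) * (a + b)))) := by
    rw [eq_div_iff (RatFunc.algebraMap_ne_zero hden)]
    rw [← hxe] at h
    field_simp at h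
    rw [show (C 4 : F[X]) = 4 from rfl]
    simp only [map_mul, map_add, map_sub, map_ofNat]
    linear_combination h
  rw [hx', ratHeight_div hcop hden]
  obtain ⟨α, β, hα, hβ, hαβ⟩ := exists_isTopCoeff_max (a := a) hb
  generalize max a.natDegree b.natDegree = n at *
  rw [show 4 * n = n + n + (n + n) by ring]
  refine IsTopCoeff.max_natDegree (((hα.mul hα).add (hβ.mul hβ)).mul ((hα.mul hα).add (hβ.mul hβ)))
    (((hα.mul hβ).mul ((hα.sub hβ).mul (hα.add hβ))).C_mul 4) ?_
  -- The elimination used for coprimality is repeated on the coefficients at infinity.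
  by_contra! hcon
  have h1 : α * α + β * β = 0 := (mul_eq_zero.1 hcon.1).elim id id
  have h3 := (mul_eq_zero.1 hcon.2).resolve_left h4
  have key : (α - β) * (α + β) = 0 → False := fun h => hαβ
    ⟨mul_self_eq_zero.1 (mul_left_cancel₀ h2 (by linear_combination h1 + h)),
      mul_self_eq_zero.1 (mul_left_cancel₀ h2 (by linear_combination h1 - h))⟩
  rcases mul_eq_zero.1 h3 with h3 | h3
  · apply key
    rcases mul_eq_zero.1 h3 with h | h
    · subst h
      have : β = 0 := by simpa using h1
      simp [this]
    · subst h
      have : α = 0 := by simpa using h1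
      simp [this]
  · exact key h3

/-- As for the quadratic twist, with the forms `(a - b)(a + b)³` and `b(2a - b)³`. The only possible
common zero lies on `a + b = 2a - b = 0`, where `3a = 0`. -/
theorem ratHeight_cubic_duplication (h3 : (3 : F) ≠ 0) {y y' : RatFunc F} (hy : 2 * y - 1 ≠ 0)
    (h : (2 * y - 1) ^ 3 * y' = (y - 1) * (y + 1) ^ 3) : ratHeight y' = 4 * ratHeight y := by
  have hb := RatFunc.denom_ne_zero y
  have hab := RatFunc.isCoprime_num_denom y
  have hye := RatFunc.num_div_denom y
  rw [show ratHeight y = max y.num.natDegree y.denom.natDegree from rfl]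
  generalize y.num = a at *
  generalize y.denom = b at *
  have hb' := RatFunc.algebraMap_ne_zero hb
  have hu : ∀ p : F[X], Prime p → ∀ {c : F} {q : F[X]}, c ≠ 0 → p ∣ C c * q → p ∣ q :=
    fun p hp c q hc h => (hp.dvd_or_dvd h).resolve_left fun h =>
      hp.not_isUnit (isUnit_of_dvd_unit h (isUnit_C.2 hc.isUnit))
  have hnot : ∀ p : F[X], Prime p → p ∣ a → p ∣ b → False := fun p hp ha hb =>
    hp.not_isUnit (hab.isUnit_of_dvd' ha hb)
  have hden : b * (C 2 * a - b) ^ 3 ≠ 0 := by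
    refine mul_ne_zero hb (pow_ne_zero 3 fun h0 => hy ?_)
    rw [← hye]
    field_simp
    rw [mul_zero]
    have := congrArg (algebraMap F[X] (RatFunc F)) h0
    rw [show (C 2 : F[X]) = 2 from rfl] at this
    simpa only [map_sub, map_mul, map_ofNat, map_zero] using this
  have hcop : IsCoprime ((a - b) * (a + b) ^ 3) (b * (C 2 * a - b) ^ 3) := by
    refine isCoprime_of_prime_dvd (fun h => hden h.2) fun p hp h1 h4 => ?_
    rw [show (C 2 : F[X]) = 2 from rfl] at h4
    rcases hp.dvd_or_dvd h1 with h1 | h1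
    · rcases hp.dvd_or_dvd h4 with h4 | h4
      · exact hnot p hp (by simpa using dvd_add h1 h4) h4
      · have h4 := hp.dvd_of_dvd_pow h4
        have ha : p ∣ a := by
          have := dvd_sub h4 h1
          rwa [show 2 * a - b - (a - b) = a by ring] at this
        exact hnot p hp ha (by simpa using dvd_sub ha h1)
    · have h1 := hp.dvd_of_dvd_pow h1
      rcases hp.dvd_or_dvd h4 with h4 | h4
      · exact hnot p hp (by simpa using dvd_sub h1 h4) h4
      · have h4 := hp.dvd_of_dvd_pow h4
        have ha : p ∣ a := by
          have := dvd_add h4 h1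
          rw [show 2 * a - b + (a + b) = C 3 * a by
            rw [show (C 3 : F[X]) = 3 from rfl]; ring] at this
          exact hu p hp h3 this
        exact hnot p hp ha (by simpa using dvd_sub h1 ha)
  have hy' : y' = algebraMap F[X] (RatFunc F) ((a - b) * (a + b) ^ 3) /
      algebraMap F[X] (RatFunc F) (b * (C 2 * a - b) ^ 3) := by
    rw [eq_div_iff (RatFunc.algebraMap_ne_zero hden)]
    rw [← hye] at h
    field_simp at h
    rw [show (C 2 : F[X]) = 2 from rfl]
    simp only [map_mul, map_add, map_sub, map_ofNat, map_pow]
    linear_combination h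
  rw [hy', ratHeight_div hcop hden]
  obtain ⟨α, β, hα, hβ, hαβ⟩ := exists_isTopCoeff_max (a := a) hb
  generalize max a.natDegree b.natDegree = n at *
  rw [show 4 * n = n + 3 * n by ring]
  refine IsTopCoeff.max_natDegree ((hα.sub hβ).mul ((hα.add hβ).pow 3))
    (hβ.mul (((hα.C_mul 2).sub hβ).pow 3)) ?_
  by_contra! hcon
  rcases mul_eq_zero.1 hcon.1 with h1 | h1
  · obtain rfl := sub_eq_zero.1 h1
    have : α * α ^ 3 = 0 := by linear_combination hcon.2
    have : α = 0 := by simpa using this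
    exact hαβ ⟨this, this⟩
  · have h1 : α + β = 0 := pow_eq_zero_iff (three_ne_zero) |>.1 h1
    obtain rfl := eq_neg_of_add_eq_zero_left h1
    have : (3 : F) ^ 3 * β ^ 4 = 0 := by linear_combination -hcon.2
    have : β = 0 := by simpa [h3] using this
    exact hαβ (by simp [this])

end Height

/-! ### Linear independence and torsion -/

/-- By Euler's theorem `2^φ(N) P = P`, whereas repeated doubling multiplies the height by `4^φ(N) >
1`. Since `P ≠ 0` has odd order, no `2^m P` vanishes and the doubling formula applies at every step.
-/
theorem height_eq_zero_of_odd_torsion {G : Type*} [AddCommGroup G] (h : G → ℕ)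
    (hdup : ∀ P : G, (2 : ℕ) • P ≠ 0 → h ((2 : ℕ) • P) = 4 * h P) {N : ℕ} (hN : Odd N) {P : G}
    (hP : N • P = 0) (h0 : P ≠ 0) : h P = 0 := by
  have hcop : Nat.Coprime 2 N := (Nat.coprime_two_left).2 hN
  have hne : ∀ m : ℕ, 2 ^ m • P ≠ 0 := fun m hm => by
    refine h0 (AddMonoid.addOrderOf_eq_one_iff.1 (Nat.eq_one_of_dvd_coprimes
      (hcop.pow_left m) (addOrderOf_dvd_of_nsmul_eq_zero hm)
      (addOrderOf_dvd_of_nsmul_eq_zero hP)))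
  have hpow : ∀ m : ℕ, h (2 ^ m • P) = 4 ^ m * h P := fun m => by
    induction m with
    | zero => simp
    | succ m ih =>
      have e : 2 ^ (m + 1) • P = 2 • 2 ^ m • P := by rw [← mul_nsmul, pow_succ]
      rw [e, hdup _ (e ▸ hne (m + 1)), ih]; ring
  have hφ : 2 ^ N.totient • P = P := by
    have h1 : 2 ^ N.totient ≡ 1 [MOD N] := Nat.ModEq.pow_totient hcop
    have h2 : 2 ^ N.totient ≡ 1 [MOD addOrderOf P] :=
      h1.of_dvd (addOrderOf_dvd_of_nsmul_eq_zero hP)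
    conv_rhs => rw [← one_nsmul P]
    exact nsmul_eq_nsmul_iff_modEq.2 h2
  have := hpow N.totient
  rw [hφ] at this
  have h4 : 1 < 4 ^ N.totient :=
    Nat.one_lt_pow (Nat.totient_pos.2 hN.pos).ne' (by norm_num)
  by_contra hcon
  have : 1 * h P < 4 ^ N.totient * h P := Nat.mul_lt_mul_of_pos_right h4 (Nat.pos_of_ne_zero hcon)
  omega

/-- A homomorphism that kills `p`-power torsion and under which a family stays independent
modulo `p` shows that the family is `ℤ`-linearly independent. -/
theorem linearIndependent_of_map_modP {G M ι : Type*} [AddCommGroup G] [AddCommGroup M]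
    [Fintype ι] {p : ℕ} (hp : 1 < p) (δ : G →+ M) (Q : ι → G)
    (htors : ∀ (n : ℕ) (P : G), p ^ n • P = 0 → δ P = 0)
    (hind : ∀ c : ι → ℤ, ∑ i, c i • δ (Q i) = 0 → ∀ i, (p : ℤ) ∣ c i) :
    LinearIndependent ℤ Q := by
  rw [Fintype.linearIndependent_iff]
  intro c hc
  have key : ∀ n : ℕ, ∃ d : ι → ℤ, ∀ i, c i = p ^ n * d i := by
    intro n
    induction n with
    | zero => exact ⟨c, by simp⟩
    | succ n ih =>
      obtain ⟨d, hd⟩ := ih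
      -- The quotient relation need not hold exactly, but its defect is `p`-power torsion, which `δ`
      -- does not see.
      have h0 : p ^ n • ∑ i, d i • Q i = 0 := by
        rw [← hc, Finset.smul_sum]
        refine Finset.sum_congr rfl fun i _ => ?_
        rw [hd i, mul_smul, ← natCast_zsmul]
        push_cast
        rfl
      have h1 := htors n _ h0
      rw [map_sum] at h1
      simp only [map_zsmul] at h1
      choose e he using hind d h1
      exact ⟨e, fun i => by rw [hd i, he i]; ring⟩
  intro i
  obtain ⟨d, hd⟩ := key (c i).natAbs
  refine Int.eq_zero_of_abs_lt_dvd (Dvd.intro _ (hd i).symm) ?_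
  rw [Int.abs_eq_natAbs]
  exact_mod_cast Nat.lt_pow_self hp

theorem eq_zero_of_sum_C_mul_eq_zero {F ι : Type*} [Field F] [Fintype ι] (f : ι → F[X])
    (hf : ∀ i, f i ≠ 0) (hdeg : Function.Injective fun i => (f i).natDegree) (c : ι → F)
    (h : ∑ i, C (c i) * f i = 0) (i : ι) : c i = 0 := by
  have h1 := degree_sum_eq_of_disjoint (fun i => C (c i) * f i) Finset.univ (by
    rintro i ⟨-, hi⟩ j ⟨-, hj⟩ hij
    simp only [Function.onFun, Function.comp]
    rw [degree_C_mul (C_ne_zero.1 (left_ne_zero_of_mul hi)),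
      degree_C_mul (C_ne_zero.1 (left_ne_zero_of_mul hj)),
      degree_eq_natDegree (hf i), degree_eq_natDegree (hf j)]
    exact fun h => hij (hdeg (by exact_mod_cast h)))
  rw [h, degree_zero] at h1
  have h2 := Finset.le_sup (f := fun i => degree (C (c i) * f i)) (Finset.mem_univ i)
  rw [← h1, le_bot_iff, degree_eq_bot, mul_eq_zero, C_eq_zero] at h2
  exact h2.resolve_right (hf i)

theorem dvd_of_sum_zsmul_eq_zero {F ι : Type*} [Field F] [Fintype ι] (p : ℕ) [CharP F p]
    (f : ι → F[X]) (hf : ∀ i, f i ≠ 0) (hdeg : Function.Injective fun i => (f i).natDegree)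
    (c : ι → ℤ) (h : ∑ i, c i • algebraMap F[X] (RatFunc F) (f i) = 0) (i : ι) :
    (p : ℤ) ∣ c i := by
  rw [← CharP.intCast_eq_zero_iff F p]
  refine eq_zero_of_sum_C_mul_eq_zero f hf hdeg (fun i => (c i : F))
    (RatFunc.algebraMap_injective F ?_) i
  rw [map_zero, ← h, map_sum]
  refine Finset.sum_congr rfl fun i _ => ?_
  rw [zsmul_eq_mul, map_mul, map_intCast, map_intCast]

/-! ### Functoriality of the group law in the field -/

/-- The target curve is tied to the base change only by an equation, so that the Frobenius twist of
one `E_A` can be identified with another. -/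
theorem exists_pointMap {K L : Type*} [Field K] [Field L] [DecidableEq K] [DecidableEq L]
    (f : K →+* L) {W : WeierstrassCurve K} {W' : WeierstrassCurve L} (hW : W.map f = W') :
    ∃ φ : W.toAffine.Point →+ W'.toAffine.Point, Function.Injective φ ∧
      ∀ x y h, ∃ h', φ (.some x y h) = .some (f x) (f y) h' := by
  subst hW
  let := f.toAlgebra
  exact ⟨WeierstrassCurve.Affine.Point.map (W' := W) (Algebra.ofId K L),
    WeierstrassCurve.Affine.Point.map_injective _, fun x y h => ⟨_, rfl⟩⟩

theorem ratFunc_natCast_ne_zero {F : Type*} [Field F] {n : ℕ} (h : (n : F) ≠ 0) :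
    (n : RatFunc F) ≠ 0 := by
  rw [← map_natCast (algebraMap F[X] (RatFunc F)), ← map_natCast C]
  exact RatFunc.algebraMap_ne_zero (C_ne_zero.2 h)

/-! ### Torsion points have vanishing differential -/

section Torsion

variable {F : Type*} [Field F] [DecidableEq (RatFunc F)]

/-- The height of the `x`-coordinate of a point of `A y² = x³ - x`. -/
def quadHeight (A : RatFunc F) : (quadTwist A).toAffine.Point → ℕ
  | .zero => 0
  | .some X _ _ => ratHeight (X / A)

theorem quadHeight_two_nsmul (h2 : (2 : F) ≠ 0) {A : RatFunc F} (hA : A ≠ 0)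
    (P : (quadTwist A).toAffine.Point) (hP : (2 : ℕ) • P ≠ 0) :
    quadHeight A ((2 : ℕ) • P) = 4 * quadHeight A P := by
  rcases P with _ | ⟨X, Y, h⟩
  · exact absurd (nsmul_zero 2) hP
  obtain ⟨hY, X', Y', h', e, hdup⟩ := quadTwist_two_nsmul h hP
  rw [e]
  have e := (quadTwist_equation_iff A X Y).1 h.1
  refine ratHeight_quad_duplication h2 ?_ ?_
  · intro h0
    field_simp at h0
    exact hY (pow_eq_zero_iff two_ne_zero |>.1 (by linear_combination e + h0))
  · field_simp
    linear_combination hdup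

theorem quadDiff_eq_zero_of_odd_torsion (h2 : (2 : F) ≠ 0) {A : RatFunc F} (hA : A ≠ 0) {N : ℕ}
    (hN : Odd N) {P : (quadTwist A).toAffine.Point} (hP : N • P = 0) :
    quadDiff (ratDeriv F) A P = 0 := by
  by_cases h0 : P = 0
  · rw [h0]; rfl
  have h := height_eq_zero_of_odd_torsion (quadHeight A) (quadHeight_two_nsmul h2 hA) hN hP h0
  rcases P with _ | ⟨X, Y, hXY⟩
  · rfl
  obtain ⟨c, hc⟩ := exists_C_of_ratHeight_eq_zero h
  rw [div_eq_iff hA] at hc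
  simp only [quadDiff, hc, Derivation.leibniz, ratDeriv_algebraMap, derivative_C, map_zero,
    smul_eq_mul]
  rw [div_eq_zero_iff]
  left; ring

/-- The height of the `y`-coordinate of a point of `y² - y = A x³`. -/
def cubicHeight (A : RatFunc F) : (cubicTwist A).toAffine.Point → ℕ
  | .zero => 0
  | .some _ Y _ => ratHeight (Y / A)

theorem cubicHeight_two_nsmul (h3 : (3 : F) ≠ 0) {A : RatFunc F} (hA : A ≠ 0)
    (P : (cubicTwist A).toAffine.Point) (hP : (2 : ℕ) • P ≠ 0) :
    cubicHeight A ((2 : ℕ) • P) = 4 * cubicHeight A P := by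
  rcases P with _ | ⟨X, Y, h⟩
  · exact absurd (nsmul_zero 2) hP
  obtain ⟨hY, X', Y', h', e, hdup⟩ := cubicTwist_two_nsmul h hP
  rw [e]
  refine ratHeight_cubic_duplication h3 ?_ ?_
  · intro h0
    field_simp at h0
    exact hY (by linear_combination h0)
  · field_simp
    linear_combination hdup

theorem cubicDiff_eq_zero_of_odd_torsion (h3 : (3 : F) ≠ 0) {A : RatFunc F} (hA : A ≠ 0) {N : ℕ}
    (hN : Odd N) {P : (cubicTwist A).toAffine.Point} (hP : N • P = 0) :
    cubicDiff (ratDeriv F) A P = 0 := by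
  by_cases h0 : P = 0
  · rw [h0]; rfl
  have h := height_eq_zero_of_odd_torsion (cubicHeight A) (cubicHeight_two_nsmul h3 hA) hN hP h0
  rcases P with _ | ⟨X, Y, hXY⟩
  · rfl
  obtain ⟨c, hc⟩ := exists_C_of_ratHeight_eq_zero h
  rw [div_eq_iff hA] at hc
  simp only [cubicDiff, hc, Derivation.leibniz, ratDeriv_algebraMap, derivative_C, map_zero,
    smul_eq_mul]
  rw [div_eq_zero_iff]
  left; ring

/-- In characteristic two the cubic twist is supersingular with trivial `2`-power torsion. -/
theorem cubicTwist_two_pow_torsion (h2 : (2 : F) = 0) {A : RatFunc F} (hA : A ≠ 0) (n : ℕ)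
    {P : (cubicTwist A).toAffine.Point} (hP : 2 ^ n • P = 0) : P = 0 := by
  have key : ∀ P : (cubicTwist A).toAffine.Point, (2 : ℕ) • P = 0 → P = 0 := by
    intro P hP
    rcases P with _ | ⟨X, Y, h⟩
    · rfl
    rw [two_nsmul, ← eq_neg_iff_add_eq_zero, WeierstrassCurve.Affine.Point.neg_some,
      WeierstrassCurve.Affine.Point.some.injEq] at hP
    have h2' : (2 : RatFunc F) = 0 := by
      rw [← map_ofNat (algebraMap F[X] (RatFunc F)) 2, ← map_ofNat C 2, h2, map_zero, map_zero]
    have := hP.2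
    simp only [WeierstrassCurve.Affine.negY, cubicTwist] at this
    -- `2P = 0` means `2Y = A`, which is impossible in characteristic two as `A ≠ 0`.
    exact absurd (by linear_combination -this + Y * h2') hA
  induction n with
  | zero => simpa using hP
  | succ n ih => exact ih (key _ (by rw [← mul_nsmul, ← pow_succ]; exact hP))

end Torsion

section Additive

variable {F : Type*} [Field F] [Fintype F]

/-! ### Additive polynomials -/

theorem additivePoly_add (A B : F[X]) :
    additivePoly (A + B) = additivePoly A + additivePoly B :=
  sum_add_index _ _ _ (by simp) (by intros; rw [C_add, add_mul])

theorem additivePoly_monomial (n : ℕ) (a : F) :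
    additivePoly (monomial n a) = C a * X ^ (Fintype.card F ^ n) :=
  sum_monomial_index _ _ (by simp)

theorem additivePoly_sub (A B : F[X]) :
    additivePoly (A - B) = additivePoly A - additivePoly B := by
  rw [eq_sub_iff_add_eq, ← additivePoly_add, sub_add_cancel]

theorem additivePoly_one : additivePoly (1 : F[X]) = X := by
  have := additivePoly_monomial 0 (1 : F)
  rwa [monomial_zero_one, C_1, one_mul, pow_zero, pow_one] at this

/-- Raising to the power `q` is additive and fixes the coefficients, so it only shifts the exponents
`q^i`. -/
theorem additivePoly_X_mul (B : F[X]) :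
    additivePoly (X * B) = additivePoly B ^ Fintype.card F := by
  induction B using Polynomial.induction_on' with
  | add p q hp hq =>
    rw [mul_add, additivePoly_add, hp, hq, additivePoly_add, ← FiniteField.expand_card,
      ← FiniteField.expand_card, ← FiniteField.expand_card, map_add]
  | monomial n a =>
    rw [X_mul_monomial, additivePoly_monomial, additivePoly_monomial, mul_pow, ← C_pow,
      FiniteField.pow_card, ← pow_mul, pow_succ]

theorem additivePoly_X_pow_mul (k : ℕ) (B : F[X]) :
    additivePoly (X ^ k * B) = additivePoly B ^ Fintype.card F ^ k := by
  induction k with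
  | zero => simp
  | succ k ih => rw [pow_succ', mul_assoc, additivePoly_X_mul, ih, ← pow_mul, pow_succ]

theorem additivePoly_X_pow_sub_one_mul (k : ℕ) (B : F[X]) :
    additivePoly ((X ^ k - 1) * B) =
      additivePoly B ^ Fintype.card F ^ k - additivePoly B := by
  rw [sub_mul, one_mul, additivePoly_sub, additivePoly_X_pow_mul]

theorem additivePoly_X_pow_sub_one (n : ℕ) :
    additivePoly (X ^ n - 1 : F[X]) = X ^ Fintype.card F ^ n - X := by
  have := additivePoly_X_pow_sub_one_mul n (1 : F[X])
  rwa [mul_one, additivePoly_one] at this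

/-- Every exponent `q^i` with `i > 0` vanishes in the field, so only the linear term survives. -/
theorem derivative_additivePoly (B : F[X]) : derivative (additivePoly B) = C (B.coeff 0) := by
  induction B using Polynomial.induction_on' with
  | add p q hp hq => rw [additivePoly_add, derivative_add, hp, hq, coeff_add, C_add]
  | monomial n a =>
    rw [additivePoly_monomial, derivative_C_mul_X_pow, coeff_monomial]
    rcases n with _ | n
    · simp
    · rw [if_neg (Nat.succ_ne_zero n), Nat.cast_pow, FiniteField.cast_card_eq_zero]
      simp

theorem natDegree_additivePoly {B : F[X]} (hB : B ≠ 0) :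
    (additivePoly B).natDegree = Fintype.card F ^ B.natDegree := by
  have h1 := Fintype.one_lt_card (α := F)
  have key : IsTopCoeff (additivePoly B) (Fintype.card F ^ B.natDegree) B.leadingCoeff := by
    constructor
    · refine natDegree_sum_le_of_forall_le _ _ fun i hi => (natDegree_C_mul_X_pow_le _ _).trans ?_
      exact Nat.pow_le_pow_right h1.le (le_natDegree_of_mem_supp i hi)
    · rw [additivePoly, Polynomial.sum, finsetSum_coeff]
      rw [Finset.sum_eq_single_of_mem B.natDegree (natDegree_mem_support_of_nonzero hB)]
      · simp
      · intro i _ hi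
        rw [coeff_C_mul_X_pow, if_neg fun h => hi (Nat.pow_right_injective h1 h).symm]
  exact le_antisymm key.1 (le_natDegree_of_ne_zero (by rw [key.2]; simpa using hB))

theorem additivePoly_ne_zero {B : F[X]} (hB : B ≠ 0) : additivePoly B ≠ 0 := fun h => by
  have := natDegree_additivePoly hB
  rw [h, natDegree_zero] at this
  exact (pow_pos Fintype.card_pos _).ne this

theorem tracePoly_eq {n k : ℕ} :
    additivePoly (∑ i ∈ Finset.range (n / k), X ^ (k * i)) = tracePoly F n k := by
  unfold tracePoly
  induction n / k with
  | zero => simp [additivePoly]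
  | succ m ih =>
    rw [Finset.sum_range_succ, Finset.sum_range_succ, additivePoly_add, ih,
      ← mul_one (X ^ (k * m)), additivePoly_X_pow_mul, additivePoly_one]

theorem X_pow_sub_one_eq {F : Type*} [Field F] {n k : ℕ} (h : k ∣ n) :
    (X ^ n - 1 : F[X]) = (X ^ k - 1) * ∑ i ∈ Finset.range (n / k), X ^ (k * i) := by
  have := mul_geom_sum (X ^ k : F[X]) (n / k)
  simp only [← pow_mul] at this
  rw [this, Nat.mul_div_cancel' h]

/-- The degrees `(q^(d-k) (q^k - r)) / s`, in terms of which the differentials are compared,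
determine `k`. -/
theorem injective_of_mul_add_eq {ι : Type*} {q d r s : ℕ} (hq : 1 < q) (hr : 0 < r)
    {k e : ι → ℕ} (hk : Function.Injective k) (hkd : ∀ i, k i ≤ d)
    (he : ∀ i, s * e i + r = q ^ k i) :
    Function.Injective fun i => e i * q ^ (d - k i) := by
  intro i j hij
  -- Thus `s` times the degree equals `q^d - r q^(d - k)`, and `r > 0` makes this determine `k`.
  have key : ∀ i, s * (e i * q ^ (d - k i)) + r * q ^ (d - k i) = q ^ d := fun i => by
    rw [← mul_assoc, ← add_mul, he, ← pow_add, Nat.add_sub_cancel' (hkd i)]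
  have h1 := key i
  have h2 := key j
  simp only at hij
  rw [hij, ← h2] at h1
  have := Nat.pow_right_injective hq (Nat.eq_of_mul_eq_mul_left hr (Nat.add_left_cancel h1))
  have h3 := hkd i
  have h4 := hkd j
  exact hk (by omega)

end Additive

/-! ### Characteristic, Frobenius, and independence of the differentials modulo `p` -/

section Setup

variable {F : Type*} [Field F] [Fintype F]

theorem natCast_ne_zero_of_not_dvd_card {l : ℕ} (hl : l.Prime) (h : ¬ l ∣ Fintype.card F) :
    (l : F) ≠ 0 := by
  intro h0
  obtain ⟨p, hp⟩ := CharP.exists F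
  have hpl := (CharP.cast_eq_zero_iff F p l).1 h0
  rw [(Nat.prime_dvd_prime_iff_eq (CharP.char_is_prime F p) hl).1 hpl] at hp
  exact h ((CharP.cast_eq_zero_iff F l _).1 (FiniteField.cast_card_eq_zero F))

variable (F) in
theorem exists_ringHom_pow_card :
    ∃ f : RatFunc F →+* RatFunc F, ∀ x, f x = x ^ Fintype.card F := by
  obtain ⟨p, hp⟩ := CharP.exists F
  obtain ⟨n, hn, hc⟩ := FiniteField.card F p
  have : CharP (RatFunc F) p := charP_of_injective_algebraMap (RatFunc.algebraMap_injective F) p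
  have : ExpChar (RatFunc F) p := ExpChar.prime hn
  exact ⟨iterateFrobenius (RatFunc F) p n, fun x => by rw [iterateFrobenius_def, hc]⟩

theorem derivation_pow {K : Type*} [Field K] (D : Derivation ℤ K K) (x : K) (n : ℕ) :
    D (x ^ n) = n * x ^ (n - 1) * D x := by
  rw [Derivation.leibniz_pow, nsmul_eq_mul, smul_eq_mul, mul_assoc]

theorem ratDeriv_pow_card_pow {i : ℕ} (hi : i ≠ 0) (x : RatFunc F) :
    ratDeriv F (x ^ Fintype.card F ^ i) = 0 := by
  have : ((Fintype.card F ^ i : ℕ) : RatFunc F) = 0 := by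
    rw [← map_natCast (algebraMap F[X] (RatFunc F)), ← map_natCast C, Nat.cast_pow,
      FiniteField.cast_card_eq_zero, zero_pow hi, map_zero, map_zero]
  rw [derivation_pow, this, zero_mul, zero_mul]

theorem notMem_range_C_of_ratDeriv_ne_zero {F : Type*} [Field F] {x : RatFunc F}
    (h : ratDeriv F x ≠ 0) :
    x ∉ Set.range (RatFunc.C : F →+* RatFunc F) := by
  rintro ⟨c, rfl⟩
  rw [← RatFunc.algebraMap_C, ratDeriv_algebraMap, derivative_C, map_zero] at h
  exact h rfl

section Factor

variable {F : Type*} [Field F] {A₀ B : F[X]} {k : ℕ}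

theorem right_ne_zero_of_eq (hA₀ : A₀ ≠ 0) (hB : A₀ = (X ^ k - 1) * B) : B ≠ 0 :=
  right_ne_zero_of_mul (hB ▸ hA₀)

theorem natDegree_eq_of_eq (hA₀ : A₀ ≠ 0) (hB : A₀ = (X ^ k - 1) * B) :
    A₀.natDegree = k + B.natDegree := by
  rw [hB, natDegree_mul (left_ne_zero_of_mul (hB ▸ hA₀)) (right_ne_zero_of_eq hA₀ hB),
    ← C_1, natDegree_X_pow_sub_C]

theorem coeff_zero_of_eq (hk : k ≠ 0) (hB : A₀ = (X ^ k - 1) * B) :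
    A₀.coeff 0 = -B.coeff 0 := by
  rw [hB, mul_coeff_zero, coeff_sub, coeff_X_pow, if_neg hk.symm, coeff_one_zero]
  ring

theorem eq_X_mul_divX {A : F[X]} (h : A.coeff 0 = 0) : A = X * A.divX := by
  conv_lhs => rw [← X_mul_divX_add A, h, C_0, add_zero]

theorem X_pow_sub_one_coeff_zero_ne_zero {F : Type*} [Field F] {n : ℕ} (hn : 1 ≤ n) :
    (X ^ n - 1 : F[X]).coeff 0 ≠ 0 := by
  rw [coeff_sub, coeff_X_pow, if_neg (by omega), coeff_one_zero]
  simp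

theorem X_pow_sub_one_ne_zero {F : Type*} [Field F] {n : ℕ} (hn : 1 ≤ n) :
    (X ^ n - 1 : F[X]) ≠ 0 := fun h =>
  X_pow_sub_one_coeff_zero_ne_zero (F := F) hn (by rw [h, coeff_zero])

end Factor

/-- The differentials of the points under consideration are independent modulo `p`. -/
theorem dvd_of_sum_zsmul_additivePoly_eq_zero {ι : Type*} [Fintype ι] (p : ℕ) [CharP F p]
    {s r : ℕ} (hr : 0 < r) {A₀ : F[X]} (hA₀ : A₀ ≠ 0) {k e : ι → ℕ} {B : ι → F[X]}
    (hk : Function.Injective k) (hB : ∀ i, A₀ = (X ^ k i - 1) * B i)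
    (he : ∀ i, s * e i + r = Fintype.card F ^ k i) {u : ι → F} (hu : ∀ i, u i ≠ 0) (c : ι → ℤ)
    (h : ∑ i, c i • algebraMap F[X] (RatFunc F) (C (u i) * additivePoly (B i) ^ e i) = 0)
    (i : ι) : (p : ℤ) ∣ c i := by
  have hB0 := fun i => right_ne_zero_of_eq hA₀ (hB i)
  have hd := fun i => natDegree_eq_of_eq hA₀ (hB i)
  refine dvd_of_sum_zsmul_eq_zero p _
    (fun i => mul_ne_zero (C_ne_zero.2 (hu i)) (pow_ne_zero _ (additivePoly_ne_zero (hB0 i))))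
    ?_ c h i
  have : (fun i => (C (u i) * additivePoly (B i) ^ e i).natDegree) =
      fun i => e i * Fintype.card F ^ (A₀.natDegree - k i) := by
    funext i
    rw [natDegree_C_mul (hu i), natDegree_pow, natDegree_additivePoly (hB0 i), hd i,
      Nat.add_sub_cancel_left]
  rw [this]
  exact injective_of_mul_add_eq Fintype.one_lt_card hr hk
    (fun i => by rw [hd i]; exact Nat.le_add_right _ _) he

end Setup

/-! ### The points on the quadratic twist -/

section Quad

theorem QuadCoords.eq_and_eq {K : Type*} [Field K] {A : K} (hA : A ≠ 0)
    {P : (quadTwist A).toAffine.Point} {x y x' y' : K} (h : QuadCoords A P x y)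
    (h' : QuadCoords A P x' y') : x = x' ∧ y = y' := by
  obtain ⟨n, rfl⟩ := h
  obtain ⟨n', e⟩ := h'
  rw [WeierstrassCurve.Affine.Point.some.injEq] at e
  exact ⟨mul_left_cancel₀ hA e.1, mul_left_cancel₀ (pow_ne_zero 2 hA) e.2⟩

theorem QuadCoords.unique {K : Type*} [Field K] {A : K}
    {P P' : (quadTwist A).toAffine.Point} {x y : K} (h : QuadCoords A P x y)
    (h' : QuadCoords A P' x y) : P = P' := by
  obtain ⟨n, rfl⟩ := h
  obtain ⟨n', rfl⟩ := h'
  rfl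

theorem QuadCoords.quadDiff_eq {K : Type*} [Field K] (D : Derivation ℤ K K) {A : K} (hA : A ≠ 0)
    {P : (quadTwist A).toAffine.Point} {x y : K} (h : QuadCoords A P x y) :
    quadDiff D A P = D x / y := by
  obtain ⟨n, rfl⟩ := h
  simp only [quadDiff, Derivation.leibniz, smul_eq_mul]
  rw [← mul_div_mul_left (D x) y (pow_ne_zero 2 hA)]
  congr 1; ring

variable {F : Type*} [Field F] [Fintype F]

/-- Constants have zero derivative, and so does the `x`-coordinate of an `i`-th Frobenius image with
`i > 0`, being a `q^i`-th power; `i = 0` gives the point itself. -/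
theorem quadSeparable_of_ratDeriv_ne_zero {A : RatFunc F} (hA : A ≠ 0)
    {P : (quadTwist A).toAffine.Point} {x y : RatFunc F} (h : QuadCoords A P x y)
    (hx : ratDeriv F x ≠ 0) : QuadSeparable A P := by
  refine ⟨⟨x, y, h, notMem_range_C_of_ratDeriv_ne_zero hx⟩, ?_⟩
  rintro R (⟨rfl, rfl⟩ | ⟨i, x₀, y₀, hR, hP⟩)
  · rfl
  rcases Nat.eq_zero_or_pos i with rfl | hi
  · simp only [pow_zero, Nat.sub_self, Nat.zero_div, one_mul, pow_one] at hP
    exact hR.unique hP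
  · rw [(h.eq_and_eq hA hP).1, ratDeriv_pow_card_pow hi.ne'] at hx
    exact absurd rfl hx

theorem two_ne_zero_of_card_mod_four (hq : Fintype.card F % 4 = 3) : (2 : F) ≠ 0 := by
  exact_mod_cast natCast_ne_zero_of_not_dvd_card Nat.prime_two (by omega)

/-- For odd `k`, `q^k` is again `3` modulo `4`, so both truncated divisions are exact. -/
theorem exists_pow_eq_four_mul_add {q k : ℕ} (hq : q % 4 = 3) (hk : Odd k) :
    ∃ N, 4 * N + 3 = q ^ k ∧ (q ^ k - 1) / 2 = 2 * N + 1 ∧ (q ^ k - 3) / 4 = N := by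
  have h : q ^ k % 4 = 3 := by
    obtain ⟨j, rfl⟩ := hk
    rw [Nat.pow_mod, hq, pow_succ, pow_mul, Nat.mul_mod, Nat.pow_mod]
    norm_num
  exact ⟨q ^ k / 4, by omega, by omega, by omega⟩

theorem natCast_mul_add_eq_zero {s r e k : ℕ} (hk : k ≠ 0)
    (he : s * e + r = Fintype.card F ^ k) : (s : F) * e + r = 0 := by
  have := congrArg (Nat.cast : ℕ → F) he
  rwa [Nat.cast_pow, FiniteField.cast_card_eq_zero, zero_pow hk, Nat.cast_add, Nat.cast_mul]
    at this

/-- With `b = B(𝐅)` and `q^k = 4N + 3`, one has `A = b^(4N+3) - b`, and both sides of the curve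
equation equal `b^(6N+3) - b^(2N+1)`. -/
theorem exists_quadCoords_of_eq (hq : Fintype.card F % 4 = 3) {A₀ B : F[X]} {k : ℕ} (hA₀ : A₀ ≠ 0)
    (hk : Odd k) (hB : A₀ = (X ^ k - 1) * B) :
    ∃ P, QuadCoords (algebraMap F[X] (RatFunc F) (additivePoly A₀)) P
      (algebraMap F[X] (RatFunc F) (additivePoly B ^ ((Fintype.card F ^ k - 1) / 2)))
      (algebraMap F[X] (RatFunc F) (additivePoly B ^ ((Fintype.card F ^ k - 3) / 4))) := by
  have h2 : (2 : RatFunc F) ≠ 0 := by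
    exact_mod_cast ratFunc_natCast_ne_zero (F := F) (n := 2)
      (by exact_mod_cast two_ne_zero_of_card_mod_four hq)
  rw [exists_quadCoords_iff (RatFunc.algebraMap_ne_zero (additivePoly_ne_zero hA₀)) h2]
  obtain ⟨N, h, h1, h3⟩ := exists_pow_eq_four_mul_add hq hk
  rw [h1, h3, hB, additivePoly_X_pow_sub_one_mul, ← h]
  simp only [map_pow, map_sub]
  generalize algebraMap F[X] (RatFunc F) (additivePoly B) = b
  ring

/-- One factor `b^N` is kept apart because it is the `y`-coordinate, which cancels in `D(x)/y`. -/
theorem ratDeriv_quadCoords {k N : ℕ} (hk : Odd k)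
    (hN : 4 * N + 3 = Fintype.card F ^ k) {B : F[X]} (hB : B.coeff 0 ≠ 0) :
    ∃ u : F, u ≠ 0 ∧ ratDeriv F (algebraMap F[X] (RatFunc F) (additivePoly B ^ (2 * N + 1))) =
      algebraMap F[X] (RatFunc F) (C u * additivePoly B ^ N * additivePoly B ^ N) := by
  refine ⟨(2 * N + 1 : ℕ) * B.coeff 0, mul_ne_zero (fun h => ?_) hB, ?_⟩
  · have h1 := natCast_mul_add_eq_zero (F := F) hk.pos.ne' hN
    push_cast at h h1
    -- In `F` one has `4N + 3 = q^k = 0`, so `2(2N + 1) = -1`.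
    exact one_ne_zero (α := F) (by linear_combination h1 - 2 * h)
  · rw [ratDeriv_algebraMap, derivative_pow, derivative_additivePoly, C_mul, Nat.add_sub_cancel]
    refine congrArg _ ?_
    rw [show 2 * N = N + N from two_mul N, pow_add, mul_right_comm, ← mul_assoc]

theorem quadSeparable_of_coords (hq : Fintype.card F % 4 = 3) {A₀ B : F[X]} {k : ℕ} (hA₀ : A₀ ≠ 0)
    (hk : Odd k) (hB : A₀ = (X ^ k - 1) * B) (h0 : A₀.coeff 0 ≠ 0)
    {P : (quadTwist (algebraMap F[X] (RatFunc F) (additivePoly A₀))).toAffine.Point}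
    (hP : QuadCoords _ P
      (algebraMap F[X] (RatFunc F) (additivePoly B ^ ((Fintype.card F ^ k - 1) / 2)))
      (algebraMap F[X] (RatFunc F) (additivePoly B ^ ((Fintype.card F ^ k - 3) / 4)))) :
    QuadSeparable _ P := by
  have hb := additivePoly_ne_zero (right_ne_zero_of_eq hA₀ hB)
  obtain ⟨N, h, h1, h3⟩ := exists_pow_eq_four_mul_add hq hk
  obtain ⟨u, hu, he⟩ := ratDeriv_quadCoords hk h (B := B)
    fun h => h0 (by rw [coeff_zero_of_eq hk.pos.ne' hB, h, neg_zero])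
  refine quadSeparable_of_ratDeriv_ne_zero
    (RatFunc.algebraMap_ne_zero (additivePoly_ne_zero hA₀)) hP ?_
  rw [h1, he]
  exact RatFunc.algebraMap_ne_zero (mul_ne_zero (mul_ne_zero (C_ne_zero.2 hu) (pow_ne_zero _ hb))
    (pow_ne_zero _ hb))

variable [DecidableEq (RatFunc F)] {ι : Type*} [Fintype ι]

theorem quad_linearIndependent_of_coeff_zero_ne_zero (hq : Fintype.card F % 4 = 3) {A₀ : F[X]}
    {k : ι → ℕ} {B : ι → F[X]} (hA₀ : A₀ ≠ 0) (hk : Function.Injective k) (hodd : ∀ i, Odd (k i))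
    (hB : ∀ i, A₀ = (X ^ k i - 1) * B i) (h0 : A₀.coeff 0 ≠ 0)
    {Q : ι → (quadTwist (algebraMap F[X] (RatFunc F) (additivePoly A₀))).toAffine.Point}
    (hQ : ∀ i, QuadCoords _ (Q i)
      (algebraMap F[X] (RatFunc F) (additivePoly (B i) ^ ((Fintype.card F ^ k i - 1) / 2)))
      (algebraMap F[X] (RatFunc F) (additivePoly (B i) ^ ((Fintype.card F ^ k i - 3) / 4)))) :
    LinearIndependent ℤ Q := by
  have h2 := two_ne_zero_of_card_mod_four hq
  have h2' : (2 : RatFunc F) ≠ 0 := by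
    exact_mod_cast ratFunc_natCast_ne_zero (F := F) (n := 2) (by exact_mod_cast h2)
  have hA := RatFunc.algebraMap_ne_zero (additivePoly_ne_zero hA₀)
  obtain ⟨p, hp⟩ := CharP.exists F
  have hpp := CharP.char_is_prime F p
  -- Oddness of `p` makes `p`-power torsion odd torsion, to which the height argument applies.
  have hpo : Odd p := hpp.odd_of_ne_two (by rintro rfl; exact h2 (CharP.cast_eq_zero F 2))
  choose N hN h1 h3 using fun i => exists_pow_eq_four_mul_add (q := Fintype.card F) hq (hodd i)
  have hB0 : ∀ i, (B i).coeff 0 ≠ 0 := fun i h =>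
    h0 (by rw [coeff_zero_of_eq (hodd i).pos.ne' (hB i), h, neg_zero])
  choose u hu he using fun i => ratDeriv_quadCoords (hodd i) (hN i) (hB0 i)
  refine linearIndependent_of_map_modP hpp.one_lt
    (AddMonoidHom.mk' (quadDiff (ratDeriv F) _) (quadDiff_add (ratDeriv F) h2')) Q
    (fun n P hP => quadDiff_eq_zero_of_odd_torsion h2 hA (hpo.pow) hP) fun c hc =>
      dvd_of_sum_zsmul_additivePoly_eq_zero p (by norm_num : 0 < 3) hA₀ hk hB hN hu c ?_
  rw [← hc]
  refine Finset.sum_congr rfl fun i _ => ?_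
  have hb := RatFunc.algebraMap_ne_zero
    (pow_ne_zero (N i) (additivePoly_ne_zero (right_ne_zero_of_eq hA₀ (hB i))))
  rw [AddMonoidHom.mk'_apply, (hQ i).quadDiff_eq _ hA, h1, h3, he, map_mul _ (C _ * _),
    mul_div_cancel_right₀ _ hb]

/-- When `A₀(0) = 0` the differentials all vanish and carry no information. But then `t` divides
`A₀` and every `B i`, and the `q`-power map of `K` induces an injective homomorphism from the curve
of `A₀/t` to that of `A₀`, carrying points to points. Induction on the degree removes all factors
`t`. -/
theorem exists_quad_linearIndependent (hq : Fintype.card F % 4 = 3) {k : ι → ℕ}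
    (hk : Function.Injective k) (hodd : ∀ i, Odd (k i)) (d : ℕ) :
    ∀ {A₀ : F[X]} {B : ι → F[X]}, A₀.natDegree = d → A₀ ≠ 0 →
      (∀ i, A₀ = (X ^ k i - 1) * B i) →
      ∃ Q : ι → (quadTwist (algebraMap F[X] (RatFunc F) (additivePoly A₀))).toAffine.Point,
        (∀ i, QuadCoords _ (Q i)
          (algebraMap F[X] (RatFunc F) (additivePoly (B i) ^ ((Fintype.card F ^ k i - 1) / 2)))
          (algebraMap F[X] (RatFunc F)
            (additivePoly (B i) ^ ((Fintype.card F ^ k i - 3) / 4)))) ∧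
        LinearIndependent ℤ Q := by
  induction d with
  | zero =>
    intro A₀ B hd hA₀ hB
    choose Q hQ using fun i => exists_quadCoords_of_eq hq hA₀ (hodd i) (hB i)
    refine ⟨Q, hQ, quad_linearIndependent_of_coeff_zero_ne_zero hq hA₀ hk hodd hB ?_ hQ⟩
    rw [← hd]
    exact leadingCoeff_ne_zero.2 hA₀
  | succ d ih =>
    intro A₀ B hd hA₀ hB
    by_cases h0 : A₀.coeff 0 = 0
    · have hA := eq_X_mul_divX h0
      have hBX : ∀ i, B i = X * (B i).divX := fun i => eq_X_mul_divX (by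
        rw [coeff_zero_of_eq (hodd i).pos.ne' (hB i), neg_eq_zero] at h0; exact h0)
      obtain ⟨Q, hQ, hli⟩ := ih (A₀ := A₀.divX) (B := fun i => (B i).divX)
        (by rw [natDegree_divX_eq_natDegree_tsub_one, hd]; rfl)
        (right_ne_zero_of_mul (hA ▸ hA₀))
        (fun i => mul_left_cancel₀ X_ne_zero (by
          rw [← hA, mul_left_comm, ← hBX]; exact hB i))
      obtain ⟨f, hf⟩ := exists_ringHom_pow_card F
      have hmap : (quadTwist (algebraMap F[X] (RatFunc F) (additivePoly A₀.divX))).map f =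
          quadTwist (algebraMap F[X] (RatFunc F) (additivePoly A₀)) := by
        conv_rhs => rw [hA, additivePoly_X_mul, map_pow, ← hf]
        ext <;> simp [quadTwist]
      obtain ⟨φ, hφ, hφs⟩ := exists_pointMap f hmap
      refine ⟨fun i => φ (Q i), fun i => ?_,
        hli.map' φ.toIntLinearMap (LinearMap.ker_eq_bot.2 hφ)⟩
      obtain ⟨n, hQi⟩ := hQ i
      obtain ⟨n', e⟩ := hφs _ _ n
      have e1 : ∀ m : ℕ, f (algebraMap F[X] (RatFunc F) (additivePoly (B i).divX ^ m)) =
          algebraMap F[X] (RatFunc F) (additivePoly (B i) ^ m) := fun m => by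
        conv_rhs => rw [hBX i, additivePoly_X_mul]
        rw [hf, ← map_pow, ← pow_mul, ← pow_mul, mul_comm]
      have e2 : f (algebraMap F[X] (RatFunc F) (additivePoly A₀.divX)) =
          algebraMap F[X] (RatFunc F) (additivePoly A₀) := by
        conv_rhs => rw [hA, additivePoly_X_mul, map_pow, ← hf]
      have e3 : f (algebraMap F[X] (RatFunc F) (additivePoly A₀.divX) *
            algebraMap F[X] (RatFunc F)
              (additivePoly (B i).divX ^ ((Fintype.card F ^ k i - 1) / 2))) =
          algebraMap F[X] (RatFunc F) (additivePoly A₀) *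
            algebraMap F[X] (RatFunc F)
              (additivePoly (B i) ^ ((Fintype.card F ^ k i - 1) / 2)) := by
        rw [map_mul, e1, e2]
      have e4 : f (algebraMap F[X] (RatFunc F) (additivePoly A₀.divX) ^ 2 *
            algebraMap F[X] (RatFunc F)
              (additivePoly (B i).divX ^ ((Fintype.card F ^ k i - 3) / 4))) =
          algebraMap F[X] (RatFunc F) (additivePoly A₀) ^ 2 *
            algebraMap F[X] (RatFunc F)
              (additivePoly (B i) ^ ((Fintype.card F ^ k i - 3) / 4)) := by
        rw [map_mul, map_pow, e1, e2]
      refine ⟨by rw [← e3, ← e4]; exact n', ?_⟩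
      simp only [hQi, e, e3, e4]
    · choose Q hQ using fun i => exists_quadCoords_of_eq hq hA₀ (hodd i) (hB i)
      exact ⟨Q, hQ, quad_linearIndependent_of_coeff_zero_ne_zero hq hA₀ hk hodd hB h0 hQ⟩

theorem exists_quad_points (hq : Fintype.card F % 4 = 3) {k : ι → ℕ} (hk : Function.Injective k)
    (hodd : ∀ i, Odd (k i)) {A₀ : F[X]} {B : ι → F[X]} (hA₀ : A₀ ≠ 0)
    (hB : ∀ i, A₀ = (X ^ k i - 1) * B i) :
    ∃ Q : ι → (quadTwist (algebraMap F[X] (RatFunc F) (additivePoly A₀))).toAffine.Point,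
      (∀ i, QuadCoords _ (Q i)
        (algebraMap F[X] (RatFunc F) (additivePoly (B i) ^ ((Fintype.card F ^ k i - 1) / 2)))
        (algebraMap F[X] (RatFunc F) (additivePoly (B i) ^ ((Fintype.card F ^ k i - 3) / 4)))) ∧
      (A₀.coeff 0 ≠ 0 → ∀ i, QuadSeparable _ (Q i)) ∧ LinearIndependent ℤ Q := by
  obtain ⟨Q, hQ, hli⟩ := exists_quad_linearIndependent hq hk hodd _ rfl hA₀ hB
  exact ⟨Q, hQ, fun h0 i => quadSeparable_of_coords hq hA₀ (hodd i) (hB i) h0 (hQ i), hli⟩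

theorem exists_quad_tracePoly_points (hq : Fintype.card F % 4 = 3) {n : ℕ} (hn : 1 ≤ n) :
    ∃ Q : oddDivisors n → (quadTwist
        (algebraMap F[X] (RatFunc F) (X ^ Fintype.card F ^ n - X))).toAffine.Point,
      (∀ k, QuadCoords _ (Q k)
        (algebraMap F[X] (RatFunc F)
          (tracePoly F n k ^ ((Fintype.card F ^ (k : ℕ) - 1) / 2)))
        (algebraMap F[X] (RatFunc F)
          (tracePoly F n k ^ ((Fintype.card F ^ (k : ℕ) - 3) / 4)))) ∧
      (∀ k, QuadSeparable _ (Q k)) ∧ LinearIndependent ℤ Q := by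
  have h := exists_quad_points hq (ι := oddDivisors n) (k := fun k => (k : ℕ))
    Subtype.val_injective (fun k => (Finset.mem_filter.1 k.2).2) (A₀ := X ^ n - 1)
    (B := fun k => ∑ i ∈ Finset.range (n / k), X ^ ((k : ℕ) * i)) (X_pow_sub_one_ne_zero hn)
    (fun k => X_pow_sub_one_eq (Nat.dvd_of_mem_divisors (Finset.mem_filter.1 k.2).1))
  simp only [tracePoly_eq] at h
  rw [additivePoly_X_pow_sub_one] at h
  obtain ⟨Q, hQ, hsep, hli⟩ := h
  exact ⟨Q, hQ, hsep (X_pow_sub_one_coeff_zero_ne_zero hn), hli⟩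

end Quad

/-! ### The points on the cubic twist -/

section Cubic

theorem CubicCoords.eq_and_eq {K : Type*} [Field K] {A : K} (hA : A ≠ 0)
    {P : (cubicTwist A).toAffine.Point} {x y x' y' : K} (h : CubicCoords A P x y)
    (h' : CubicCoords A P x' y') : x = x' ∧ y = y' := by
  obtain ⟨n, rfl⟩ := h
  obtain ⟨n', e⟩ := h'
  rw [WeierstrassCurve.Affine.Point.some.injEq] at e
  exact ⟨mul_left_cancel₀ hA e.1, mul_left_cancel₀ hA e.2⟩

theorem CubicCoords.unique {K : Type*} [Field K] {A : K}
    {P P' : (cubicTwist A).toAffine.Point} {x y : K} (h : CubicCoords A P x y)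
    (h' : CubicCoords A P' x y) : P = P' := by
  obtain ⟨n, rfl⟩ := h
  obtain ⟨n', rfl⟩ := h'
  rfl

theorem CubicCoords.cubicDiff_eq {K : Type*} [Field K] (D : Derivation ℤ K K) {A : K} (hA : A ≠ 0)
    {P : (cubicTwist A).toAffine.Point} {x y : K} (h : CubicCoords A P x y) :
    cubicDiff D A P = D y / x ^ 2 := by
  obtain ⟨n, rfl⟩ := h
  simp only [cubicDiff, Derivation.leibniz, smul_eq_mul]
  rw [mul_pow, ← mul_div_mul_left (D y) (x ^ 2) (pow_ne_zero 2 hA)]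
  congr 1; ring

variable {F : Type*} [Field F] [Fintype F]

/-- Here `y` plays the role of `x`: it is the coordinate that Frobenius raises to a power without a
factor from `A`. -/
theorem cubicSeparable_of_ratDeriv_ne_zero {A : RatFunc F} (hA : A ≠ 0)
    {P : (cubicTwist A).toAffine.Point} {x y : RatFunc F} (h : CubicCoords A P x y)
    (hy : ratDeriv F y ≠ 0) : CubicSeparable A P := by
  refine ⟨⟨x, y, h, notMem_range_C_of_ratDeriv_ne_zero hy⟩, ?_⟩
  rintro R (⟨rfl, rfl⟩ | ⟨i, x₀, y₀, hR, hP⟩)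
  · rfl
  rcases Nat.eq_zero_or_pos i with rfl | hi
  · simp only [mul_zero, pow_zero, Nat.sub_self, Nat.zero_div, one_mul, pow_one] at hP
    exact hR.unique hP
  · rw [(h.eq_and_eq hA hP).2, ratDeriv_pow_card_pow (by omega)] at hy
    exact absurd rfl hy

theorem three_ne_zero_of_card_mod_three (hq : Fintype.card F % 3 = 2) : (3 : F) ≠ 0 := by
  exact_mod_cast natCast_ne_zero_of_not_dvd_card Nat.prime_three (by omega)

theorem exists_pow_eq_three_mul_add {q k : ℕ} (hq : q % 3 = 2) (hk : Odd k) :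
    ∃ N, 3 * N + 2 = q ^ k ∧ (q ^ k - 2) / 3 = N ∧ q ^ k - 1 = 3 * N + 1 := by
  have h : q ^ k % 3 = 2 := by
    obtain ⟨j, rfl⟩ := hk
    rw [Nat.pow_mod, hq, pow_succ, pow_mul, Nat.mul_mod, Nat.pow_mod]
    norm_num
  exact ⟨q ^ k / 3, by omega, by omega, by omega⟩

/-- With `b = B(𝐅)` and `q^k = 3N + 2`, both sides of the curve equation equal `b^(6N+2) -
b^(3N+1)`. -/
theorem exists_cubicCoords_of_eq (hq : Fintype.card F % 3 = 2) {A₀ B : F[X]} {k : ℕ} (hA₀ : A₀ ≠ 0)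
    (hk : Odd k) (hB : A₀ = (X ^ k - 1) * B) :
    ∃ P, CubicCoords (algebraMap F[X] (RatFunc F) (additivePoly A₀)) P
      (algebraMap F[X] (RatFunc F) (additivePoly B ^ ((Fintype.card F ^ k - 2) / 3)))
      (algebraMap F[X] (RatFunc F) (additivePoly B ^ (Fintype.card F ^ k - 1))) := by
  have h3 : (3 : RatFunc F) ≠ 0 := by
    exact_mod_cast ratFunc_natCast_ne_zero (F := F) (n := 3)
      (by exact_mod_cast three_ne_zero_of_card_mod_three hq)
  rw [exists_cubicCoords_iff (RatFunc.algebraMap_ne_zero (additivePoly_ne_zero hA₀)) h3]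
  obtain ⟨N, h, h1, h4⟩ := exists_pow_eq_three_mul_add hq hk
  rw [h1, h4, hB, additivePoly_X_pow_sub_one_mul, ← h]
  simp only [map_pow, map_sub]
  generalize algebraMap F[X] (RatFunc F) (additivePoly B) = b
  ring

theorem ratDeriv_cubicCoords {k N : ℕ} (hk : Odd k)
    (hN : 3 * N + 2 = Fintype.card F ^ k) {B : F[X]} (hB : B.coeff 0 ≠ 0) :
    ∃ u : F, u ≠ 0 ∧ ratDeriv F (algebraMap F[X] (RatFunc F) (additivePoly B ^ (3 * N + 1))) =
      algebraMap F[X] (RatFunc F)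
        (C u * additivePoly B ^ N * (additivePoly B ^ N) ^ 2) := by
  refine ⟨(3 * N + 1 : ℕ) * B.coeff 0, mul_ne_zero (fun h => ?_) hB, ?_⟩
  · have h1 := natCast_mul_add_eq_zero (F := F) hk.pos.ne' hN
    push_cast at h h1
    -- In `F` one has `3N + 2 = q^k = 0`, so `3N + 1 = -1`.
    exact one_ne_zero (α := F) (by linear_combination h1 - h)
  · rw [ratDeriv_algebraMap, derivative_pow, derivative_additivePoly, C_mul, Nat.add_sub_cancel]
    refine congrArg _ ?_
    rw [mul_right_comm, mul_assoc _ (_ ^ N), ← pow_succ', ← pow_mul, mul_comm 3 N]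

theorem cubicSeparable_of_coords (hq : Fintype.card F % 3 = 2) {A₀ B : F[X]} {k : ℕ} (hA₀ : A₀ ≠ 0)
    (hk : Odd k) (hB : A₀ = (X ^ k - 1) * B) (h0 : A₀.coeff 0 ≠ 0)
    {P : (cubicTwist (algebraMap F[X] (RatFunc F) (additivePoly A₀))).toAffine.Point}
    (hP : CubicCoords _ P
      (algebraMap F[X] (RatFunc F) (additivePoly B ^ ((Fintype.card F ^ k - 2) / 3)))
      (algebraMap F[X] (RatFunc F) (additivePoly B ^ (Fintype.card F ^ k - 1)))) :
    CubicSeparable _ P := by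
  have hb := additivePoly_ne_zero (right_ne_zero_of_eq hA₀ hB)
  obtain ⟨N, h, h1, h4⟩ := exists_pow_eq_three_mul_add hq hk
  obtain ⟨u, hu, he⟩ := ratDeriv_cubicCoords hk h (B := B)
    fun h => h0 (by rw [coeff_zero_of_eq hk.pos.ne' hB, h, neg_zero])
  refine cubicSeparable_of_ratDeriv_ne_zero
    (RatFunc.algebraMap_ne_zero (additivePoly_ne_zero hA₀)) hP ?_
  rw [h4, he]
  exact RatFunc.algebraMap_ne_zero (mul_ne_zero (mul_ne_zero (C_ne_zero.2 hu) (pow_ne_zero _ hb))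
    (pow_ne_zero 2 (pow_ne_zero _ hb)))

variable [DecidableEq (RatFunc F)] {ι : Type*} [Fintype ι]

theorem cubic_linearIndependent_of_coeff_zero_ne_zero (hq : Fintype.card F % 3 = 2) {A₀ : F[X]}
    {k : ι → ℕ} {B : ι → F[X]} (hA₀ : A₀ ≠ 0) (hk : Function.Injective k) (hodd : ∀ i, Odd (k i))
    (hB : ∀ i, A₀ = (X ^ k i - 1) * B i) (h0 : A₀.coeff 0 ≠ 0)
    {Q : ι → (cubicTwist (algebraMap F[X] (RatFunc F) (additivePoly A₀))).toAffine.Point}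
    (hQ : ∀ i, CubicCoords _ (Q i)
      (algebraMap F[X] (RatFunc F) (additivePoly (B i) ^ ((Fintype.card F ^ k i - 2) / 3)))
      (algebraMap F[X] (RatFunc F) (additivePoly (B i) ^ (Fintype.card F ^ k i - 1)))) :
    LinearIndependent ℤ Q := by
  have h3 := three_ne_zero_of_card_mod_three hq
  have h3' : (3 : RatFunc F) ≠ 0 := by
    exact_mod_cast ratFunc_natCast_ne_zero (F := F) (n := 3) (by exact_mod_cast h3)
  have hA := RatFunc.algebraMap_ne_zero (additivePoly_ne_zero hA₀)
  obtain ⟨p, hp⟩ := CharP.exists F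
  have hpp := CharP.char_is_prime F p
  have htors : ∀ (n : ℕ) (P : (cubicTwist (algebraMap F[X] (RatFunc F)
      (additivePoly A₀))).toAffine.Point), p ^ n • P = 0 → cubicDiff (ratDeriv F) _ P = 0 := by
    intro n P hP
    -- Doubling says nothing about `2`-power torsion, so characteristic two is treated apart: there
    -- that torsion is trivial.
    rcases hpp.eq_two_or_odd' with rfl | hpo
    · rw [cubicTwist_two_pow_torsion (CharP.cast_eq_zero F 2) hA n hP]; rfl
    · exact cubicDiff_eq_zero_of_odd_torsion h3 hA hpo.pow hP
  choose N hN h1 h4 using fun i => exists_pow_eq_three_mul_add (q := Fintype.card F) hq (hodd i)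
  have hB0 : ∀ i, (B i).coeff 0 ≠ 0 := fun i h =>
    h0 (by rw [coeff_zero_of_eq (hodd i).pos.ne' (hB i), h, neg_zero])
  choose u hu he using fun i => ratDeriv_cubicCoords (hodd i) (hN i) (hB0 i)
  refine linearIndependent_of_map_modP hpp.one_lt
    (AddMonoidHom.mk' (cubicDiff (ratDeriv F) _) (cubicDiff_add (ratDeriv F) h3')) Q
    htors fun c hc =>
      dvd_of_sum_zsmul_additivePoly_eq_zero p (by norm_num : 0 < 2) hA₀ hk hB hN hu c ?_
  rw [← hc]
  refine Finset.sum_congr rfl fun i _ => ?_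
  have hb := RatFunc.algebraMap_ne_zero
    (pow_ne_zero 2 (pow_ne_zero (N i) (additivePoly_ne_zero (right_ne_zero_of_eq hA₀ (hB i)))))
  rw [AddMonoidHom.mk'_apply, (hQ i).cubicDiff_eq _ hA, h1, h4, he, map_mul _ (C _ * _), ← map_pow,
    mul_div_cancel_right₀ _ hb]

theorem exists_cubic_linearIndependent (hq : Fintype.card F % 3 = 2) {k : ι → ℕ}
    (hk : Function.Injective k) (hodd : ∀ i, Odd (k i)) (d : ℕ) :
    ∀ {A₀ : F[X]} {B : ι → F[X]}, A₀.natDegree = d → A₀ ≠ 0 →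
      (∀ i, A₀ = (X ^ k i - 1) * B i) →
      ∃ Q : ι → (cubicTwist (algebraMap F[X] (RatFunc F) (additivePoly A₀))).toAffine.Point,
        (∀ i, CubicCoords _ (Q i)
          (algebraMap F[X] (RatFunc F) (additivePoly (B i) ^ ((Fintype.card F ^ k i - 2) / 3)))
          (algebraMap F[X] (RatFunc F)
            (additivePoly (B i) ^ (Fintype.card F ^ k i - 1)))) ∧
        LinearIndependent ℤ Q := by
  induction d with
  | zero =>
    intro A₀ B hd hA₀ hB
    choose Q hQ using fun i => exists_cubicCoords_of_eq hq hA₀ (hodd i) (hB i)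
    refine ⟨Q, hQ, cubic_linearIndependent_of_coeff_zero_ne_zero hq hA₀ hk hodd hB ?_ hQ⟩
    rw [← hd]
    exact leadingCoeff_ne_zero.2 hA₀
  | succ d ih =>
    intro A₀ B hd hA₀ hB
    by_cases h0 : A₀.coeff 0 = 0
    · have hA := eq_X_mul_divX h0
      have hBX : ∀ i, B i = X * (B i).divX := fun i => eq_X_mul_divX (by
        rw [coeff_zero_of_eq (hodd i).pos.ne' (hB i), neg_eq_zero] at h0; exact h0)
      obtain ⟨Q, hQ, hli⟩ := ih (A₀ := A₀.divX) (B := fun i => (B i).divX)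
        (by rw [natDegree_divX_eq_natDegree_tsub_one, hd]; rfl)
        (right_ne_zero_of_mul (hA ▸ hA₀))
        (fun i => mul_left_cancel₀ X_ne_zero (by
          rw [← hA, mul_left_comm, ← hBX]; exact hB i))
      obtain ⟨f, hf⟩ := exists_ringHom_pow_card F
      -- Base change along the `q`-power map replaces the twisting parameter by its `q`-th power,
      -- which is the parameter of `A₀ = X * A₀.divX`.
      have hmap : (cubicTwist (algebraMap F[X] (RatFunc F) (additivePoly A₀.divX))).map f =
          cubicTwist (algebraMap F[X] (RatFunc F) (additivePoly A₀)) := by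
        conv_rhs => rw [hA, additivePoly_X_mul, map_pow, ← hf]
        ext <;> simp [cubicTwist]
      obtain ⟨φ, hφ, hφs⟩ := exists_pointMap f hmap
      refine ⟨fun i => φ (Q i), fun i => ?_,
        hli.map' φ.toIntLinearMap (LinearMap.ker_eq_bot.2 hφ)⟩
      obtain ⟨n, hQi⟩ := hQ i
      obtain ⟨n', e⟩ := hφs _ _ n
      have e1 : ∀ m : ℕ, f (algebraMap F[X] (RatFunc F) (additivePoly (B i).divX ^ m)) =
          algebraMap F[X] (RatFunc F) (additivePoly (B i) ^ m) := fun m => by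
        conv_rhs => rw [hBX i, additivePoly_X_mul]
        rw [hf, ← map_pow, ← pow_mul, ← pow_mul, mul_comm]
      have e2 : f (algebraMap F[X] (RatFunc F) (additivePoly A₀.divX)) =
          algebraMap F[X] (RatFunc F) (additivePoly A₀) := by
        conv_rhs => rw [hA, additivePoly_X_mul, map_pow, ← hf]
      have e3 : f (algebraMap F[X] (RatFunc F) (additivePoly A₀.divX) *
            algebraMap F[X] (RatFunc F)
              (additivePoly (B i).divX ^ ((Fintype.card F ^ k i - 2) / 3))) =
          algebraMap F[X] (RatFunc F) (additivePoly A₀) *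
            algebraMap F[X] (RatFunc F)
              (additivePoly (B i) ^ ((Fintype.card F ^ k i - 2) / 3)) := by
        rw [map_mul, e1, e2]
      have e4 : f (algebraMap F[X] (RatFunc F) (additivePoly A₀.divX) *
            algebraMap F[X] (RatFunc F)
              (additivePoly (B i).divX ^ (Fintype.card F ^ k i - 1))) =
          algebraMap F[X] (RatFunc F) (additivePoly A₀) *
            algebraMap F[X] (RatFunc F)
              (additivePoly (B i) ^ (Fintype.card F ^ k i - 1)) := by
        rw [map_mul, e1, e2]
      refine ⟨by rw [← e3, ← e4]; exact n', ?_⟩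
      simp only [hQi, e, e3, e4]
    · choose Q hQ using fun i => exists_cubicCoords_of_eq hq hA₀ (hodd i) (hB i)
      exact ⟨Q, hQ, cubic_linearIndependent_of_coeff_zero_ne_zero hq hA₀ hk hodd hB h0 hQ⟩

theorem exists_cubic_points (hq : Fintype.card F % 3 = 2) {k : ι → ℕ} (hk : Function.Injective k)
    (hodd : ∀ i, Odd (k i)) {A₀ : F[X]} {B : ι → F[X]} (hA₀ : A₀ ≠ 0)
    (hB : ∀ i, A₀ = (X ^ k i - 1) * B i) :
    ∃ Q : ι → (cubicTwist (algebraMap F[X] (RatFunc F) (additivePoly A₀))).toAffine.Point,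
      (∀ i, CubicCoords _ (Q i)
        (algebraMap F[X] (RatFunc F) (additivePoly (B i) ^ ((Fintype.card F ^ k i - 2) / 3)))
        (algebraMap F[X] (RatFunc F) (additivePoly (B i) ^ (Fintype.card F ^ k i - 1)))) ∧
      (A₀.coeff 0 ≠ 0 → ∀ i, CubicSeparable _ (Q i)) ∧ LinearIndependent ℤ Q := by
  obtain ⟨Q, hQ, hli⟩ := exists_cubic_linearIndependent hq hk hodd _ rfl hA₀ hB
  exact ⟨Q, hQ, fun h0 i => cubicSeparable_of_coords hq hA₀ (hodd i) (hB i) h0 (hQ i), hli⟩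

theorem exists_cubic_tracePoly_points (hq : Fintype.card F % 3 = 2) {n : ℕ} (hn : 1 ≤ n) :
    ∃ Q : oddDivisors n → (cubicTwist
        (algebraMap F[X] (RatFunc F) (X ^ Fintype.card F ^ n - X))).toAffine.Point,
      (∀ k, CubicCoords _ (Q k)
        (algebraMap F[X] (RatFunc F)
          (tracePoly F n k ^ ((Fintype.card F ^ (k : ℕ) - 2) / 3)))
        (algebraMap F[X] (RatFunc F)
          (tracePoly F n k ^ (Fintype.card F ^ (k : ℕ) - 1)))) ∧
      (∀ k, CubicSeparable _ (Q k)) ∧ LinearIndependent ℤ Q := by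
  have h := exists_cubic_points hq (ι := oddDivisors n) (k := fun k => (k : ℕ))
    Subtype.val_injective (fun k => (Finset.mem_filter.1 k.2).2) (A₀ := X ^ n - 1)
    (B := fun k => ∑ i ∈ Finset.range (n / k), X ^ ((k : ℕ) * i)) (X_pow_sub_one_ne_zero hn)
    (fun k => X_pow_sub_one_eq (Nat.dvd_of_mem_divisors (Finset.mem_filter.1 k.2).1))
  simp only [tracePoly_eq] at h
  rw [additivePoly_X_pow_sub_one] at h
  obtain ⟨Q, hQ, hsep, hli⟩ := h
  exact ⟨Q, hQ, hsep (X_pow_sub_one_coeff_zero_ne_zero hn), hli⟩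

end Cubic

/-- A family of `ℤ`-linearly independent elements bounds the rank from below. -/
theorem card_le_rank_of_linearIndependent {G : Type*} [AddCommGroup G] {s : Finset ℕ} {Q : s → G}
    (hQ : LinearIndependent ℤ Q) : (s.card : Cardinal) ≤ Module.rank ℤ G := by
  simpa using hQ.cardinal_lift_le_rank

end TwistPoints

end

/-! ### Main theorem -/

theorem mainTheorem5 {F : Type*} [Field F] [Fintype F] [DecidableEq (RatFunc F)] :
    -- quadratic twists `A y² = x³ - x`
    (Fintype.card F % 4 = 3 →
      (∀ (m : ℕ) (k : Fin m → ℕ) (A₀ : F[X]) (B : Fin m → F[X]),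
        A₀ ≠ 0 → Function.Injective k → (∀ i, Odd (k i)) →
        (∀ i, A₀ = (X ^ k i - 1) * B i) →
        ∃ Q : Fin m → (TwistPoints.quadTwist
            (algebraMap F[X] (RatFunc F) (TwistPoints.additivePoly A₀))).toAffine.Point,
          (∀ i, TwistPoints.QuadCoords _ (Q i)
            (algebraMap F[X] (RatFunc F)
              (TwistPoints.additivePoly (B i) ^ ((Fintype.card F ^ k i - 1) / 2)))
            (algebraMap F[X] (RatFunc F)
              (TwistPoints.additivePoly (B i) ^ ((Fintype.card F ^ k i - 3) / 4)))) ∧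
          (A₀.coeff 0 ≠ 0 → ∀ i, TwistPoints.QuadSeparable _ (Q i)) ∧
          LinearIndependent ℤ Q) ∧
      (∀ n : ℕ, 1 ≤ n →
        (∃ Q : TwistPoints.oddDivisors n → (TwistPoints.quadTwist
            (algebraMap F[X] (RatFunc F) (X ^ Fintype.card F ^ n - X))).toAffine.Point,
          (∀ k, TwistPoints.QuadCoords _ (Q k)
            (algebraMap F[X] (RatFunc F)
              (TwistPoints.tracePoly F n k ^ ((Fintype.card F ^ (k : ℕ) - 1) / 2)))
            (algebraMap F[X] (RatFunc F)
              (TwistPoints.tracePoly F n k ^ ((Fintype.card F ^ (k : ℕ) - 3) / 4)))) ∧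
          (∀ k, TwistPoints.QuadSeparable _ (Q k)) ∧
          LinearIndependent ℤ Q) ∧
        ((TwistPoints.oddDivisors n).card : Cardinal) ≤
          Module.rank ℤ (TwistPoints.quadTwist
            (algebraMap F[X] (RatFunc F) (X ^ Fintype.card F ^ n - X))).toAffine.Point)) ∧
    -- cubic twists `y² - y = A x³`
    (Fintype.card F % 3 = 2 →
      (∀ (m : ℕ) (k : Fin m → ℕ) (A₀ : F[X]) (B : Fin m → F[X]),
        A₀ ≠ 0 → Function.Injective k → (∀ i, Odd (k i)) →
        (∀ i, A₀ = (X ^ k i - 1) * B i) →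
        ∃ S : Fin m → (TwistPoints.cubicTwist
            (algebraMap F[X] (RatFunc F) (TwistPoints.additivePoly A₀))).toAffine.Point,
          (∀ i, TwistPoints.CubicCoords _ (S i)
            (algebraMap F[X] (RatFunc F)
              (TwistPoints.additivePoly (B i) ^ ((Fintype.card F ^ k i - 2) / 3)))
            (algebraMap F[X] (RatFunc F)
              (TwistPoints.additivePoly (B i) ^ (Fintype.card F ^ k i - 1)))) ∧
          (A₀.coeff 0 ≠ 0 → ∀ i, TwistPoints.CubicSeparable _ (S i)) ∧
          LinearIndependent ℤ S) ∧
      (∀ n : ℕ, 1 ≤ n →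
        (∃ S : TwistPoints.oddDivisors n → (TwistPoints.cubicTwist
            (algebraMap F[X] (RatFunc F) (X ^ Fintype.card F ^ n - X))).toAffine.Point,
          (∀ k, TwistPoints.CubicCoords _ (S k)
            (algebraMap F[X] (RatFunc F)
              (TwistPoints.tracePoly F n k ^ ((Fintype.card F ^ (k : ℕ) - 2) / 3)))
            (algebraMap F[X] (RatFunc F)
              (TwistPoints.tracePoly F n k ^ (Fintype.card F ^ (k : ℕ) - 1)))) ∧
          (∀ k, TwistPoints.CubicSeparable _ (S k)) ∧
          LinearIndependent ℤ S) ∧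
        ((TwistPoints.oddDivisors n).card : Cardinal) ≤
          Module.rank ℤ (TwistPoints.cubicTwist
            (algebraMap F[X] (RatFunc F) (X ^ Fintype.card F ^ n - X))).toAffine.Point)) := by
  refine ⟨fun hq => ⟨fun m k A₀ B hA₀ hk hodd hB => ?_, fun n hn => ?_⟩,
    fun hq => ⟨fun m k A₀ B hA₀ hk hodd hB => ?_, fun n hn => ?_⟩⟩
  · exact TwistPoints.exists_quad_points hq hk hodd hA₀ hB
  · obtain ⟨Q, hQ, hsep, hli⟩ := TwistPoints.exists_quad_tracePoly_points (F := F) hq hn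
    exact ⟨⟨Q, hQ, hsep, hli⟩, TwistPoints.card_le_rank_of_linearIndependent hli⟩
  · exact TwistPoints.exists_cubic_points hq hk hodd hA₀ hB
  · obtain ⟨S, hS, hsep, hli⟩ := TwistPoints.exists_cubic_tracePoly_points (F := F) hq hn
    exact ⟨⟨S, hS, hsep, hli⟩, TwistPoints.card_le_rank_of_linearIndependent hli⟩
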